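/- Let $n\in\mathbb{N}=\{1,2,\dots\}$, $I=\{1,\dots,n\}$, $E=[0,\infty)^n$ with the trace topology and trace Borel $\sigma$-algebra of $\mathbb{R}^n$, and $s\in(0,\infty)$. For $B\subset I$ put $E_+(B)=\{x\in E : \{i : x_i>0\}=B\}$ and $$\lambda_B^{n,s}=s^{\,n-\#B}\prod_{i\in B}dx_+^i\prod_{j\in I\setminus B}d\delta_0^j,\qquad m_{n,s}=\sum_{B\subset I}\lambda_B^{n,s},$$ where $dx_+^i$ is Lebesgue measure on $[0,\infty)$ and $\delta_0^j$ the Dirac measure at $0$ in the indicated coordinates. Let $\varrho:E\to\mathbb{R}$ satisfy: (1) $\varrho>0$ $m_{n,s}$-a.e. and $\varrho\in L^1(E;m_{n,s})$; (2) (Hamza condition) for every $\varnothing\neq B\subset I$, $\varrho=0$ holds $\lambda_B^{n,s}$-a.e. on $\overline{E_+(B)}\setminus R_\varrho(\overline{E_+(B)})$, where $R_\varrho(\overline{E_+(B)})$ is the set of all $x\in\overline{E_+(B)}$ such that $\int_{\{y\in\overline{E_+(B)} : |x-y|\le\varepsilon\}}\varrho^{-1}\,d\lambda_B^{n,s}<\infty$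 for some $\varepsilon>0$. Put $\mu_{n,s,\varrho}=\varrho\,m_{n,s}$ and $\mu_B^{\varrho,n,s}=\varrho\,\lambda_B^{n,s}$. Let $C_c^2(E)$ be the set of continuous functions $f:E\to\mathbb{R}$ with compact support in $E$ which are twice continuously differentiable on $(0,\infty)^n$ and whose partial derivatives up to order two extend continuously from $(0,\infty)^n$ to $E$; $\partial_i f$ also denotes the continuous extension to $E$. Then $$\mathcal{E}(f,g)=\sum_{\varnothing\neq B\subset I}\ \sum_{i\in B}\int_{E_+(B)}\partial_i f\,\partial_i g\,d\mu_B^{\varrho,n,s},\qquad f,g\in C_c^2(E),$$ is a well-defined, densely defined, symmetric, positive (that is, $\mathcal{E}(f,f)\ge 0$) bilinear form on $L^2(E;\mu_{n,s,\varrho})$, and it is closable: if $f_k\in C_c^2(E)$, $\mathcal{E}(f_k-f_l,f_k-f_l)\to0$ as $k,l\to\infty$ and $f_k\to0$ in $L^2(E;\mu_{n,s,\varrho})$, then $\mathcal{E}(f_k,f_k)\to0$. Its closure $(\mathcal{E},D(\mathcal{E}))$, i.e. the closed extension in which $C_c^2(E)$ is dense with respect to $\mathcal{E}_1(u,u):=\mathcal{E}(u,u)+\|u\|_{L^2}^2$,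 is a symmetric Dirichlet form on $L^2(E;\mu_{n,s,\varrho})$ (a densely defined, positive, symmetric, closed form such that for $u\in D(\mathcal{E})$ the function $v=(0\vee u)\wedge1$ is in $D(\mathcal{E})$ and $\mathcal{E}(v,v)\le\mathcal{E}(u,u)$) which is * regular: $D(\mathcal{E})\cap C_c(E)$ is dense in $D(\mathcal{E})$ with respect to $\mathcal{E}_1$ and dense in $C_c(E)$ with respect to the supremum norm; * strongly local: $\mathcal{E}(u,v)=0$ for all $u,v\in D(\mathcal{E})$ with compact supports such that $v$ is constant a.e. on a neighbourhood of the support of $u$ (the support of $u$ being that of the measure $|u|\,\mu_{n,s,\varrho}$); * conservative: $T_t1=1$ for all $t>0$, where $(T_t)_{t>0}$ is the strongly continuous contraction semigroup on $L^2(E;\mu_{n,s,\varrho})$ associated with $(\mathcal{E},D(\mathcal{E}))$. -/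

import Mathlib

open MeasureTheory Filter Topology
open scoped ENNReal

noncomputable section

/-! ### Bilinear forms with a domain in a real Hilbert space -/

/-- A real bilinear form defined on a linear subspace of `H`. -/
structure PartialForm (H : Type*) [NormedAddCommGroup H] [InnerProductSpace ℝ H] where
  dom : Submodule ℝ H
  form : dom →ₗ[ℝ] dom →ₗ[ℝ] ℝ

namespace PartialForm

section Hilbert

variable {H : Type*} [NormedAddCommGroup H] [InnerProductSpace ℝ H]

def IsDenselyDefined (F : PartialForm H) : Prop := Dense (F.dom : Set H)

def IsSymmetric (F : PartialForm H) : Prop := ∀ u v : F.dom, F.form u v = F.form v u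

/-- Positive definite in the weak sense customary for Dirichlet forms: `F(u,u) ≥ 0`. -/
def IsPositive (F : PartialForm H) : Prop := ∀ u : F.dom, 0 ≤ F.form u u

/-- `F₁(u,u) = F(u,u) + (u,u)`. -/
def energyOne (F : PartialForm H) (u : F.dom) : ℝ := F.form u u + ‖(u : H)‖ ^ 2

def IsClosable (F : PartialForm H) : Prop :=
  ∀ u : ℕ → F.dom,
    (∀ ε > (0 : ℝ), ∃ N, ∀ k ≥ N, ∀ l ≥ N, F.form (u k - u l) (u k - u l) < ε) →
    Tendsto (fun k => (u k : H)) atTop (𝓝 0) →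
    Tendsto (fun k => F.form (u k) (u k)) atTop (𝓝 0)

/-- The domain is complete with respect to `F₁`. -/
def IsClosed (F : PartialForm H) : Prop :=
  ∀ u : ℕ → F.dom,
    (∀ ε > (0 : ℝ), ∃ N, ∀ k ≥ N, ∀ l ≥ N, F.energyOne (u k - u l) < ε) →
    ∃ w : F.dom, Tendsto (fun k => F.energyOne (u k - w)) atTop (𝓝 0)

/-- `G` is the closure of `F`: the closed extension of `F` in which the domain of `F` is dense
with respect to `G₁`. -/
def IsClosureOf (G F : PartialForm H) : Prop :=
  G.IsClosed ∧
  ∃ h : F.dom ≤ G.dom,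
    (∀ u v : F.dom,
      G.form (Submodule.inclusion h u) (Submodule.inclusion h v) = F.form u v) ∧
    ∀ w : G.dom, ∀ ε > (0 : ℝ), ∃ u : F.dom, G.energyOne (w - Submodule.inclusion h u) < ε

/-- `w = G_β f`, where `(G_β)` is the resolvent of the form: `w` lies in the domain and
`F(w,v) + β (w,v) = (f,v)` for all `v` in the domain. -/
def IsResolventValue (F : PartialForm H) (β : ℝ) (f w : H) : Prop :=
  ∃ hw : w ∈ F.dom, ∀ v : F.dom,
    F.form ⟨w, hw⟩ v + β * inner ℝ w (v : H) = inner ℝ f (v : H)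

open Classical in
/-- The resolvent `G_β`. For a closed positive symmetric form and `β > 0`, existence and
uniqueness of `G_β f` hold for every `f`. -/
def resolvent (F : PartialForm H) (β : ℝ) (f : H) : H :=
  if h : ∃ w, F.IsResolventValue β f w then h.choose else 0

/-- The approximation `e^{-tβ} ∑ₖ (tβ)ᵏ / k! (β G_β)ᵏ f` of `T_t f`. -/
def semigroupApprox (F : PartialForm H) (t β : ℝ) (f : H) : H :=
  Real.exp (-(t * β)) •
    ∑' k : ℕ, ((t * β) ^ k / (k.factorial : ℝ)) • (fun g : H => β • F.resolvent β g)^[k] f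

/-- `w = T_t f`, where `(T_t)` is the strongly continuous contraction semigroup of the form,
given by the Hille-Yosida formula
`T_t f = lim_{β → ∞} e^{-tβ} ∑ₖ (tβ)ᵏ / k! (β G_β)ᵏ f`. -/
def IsSemigroupValue (F : PartialForm H) (t : ℝ) (f w : H) : Prop :=
  Tendsto (fun β : ℝ => F.semigroupApprox t β f) atTop (𝓝 w)

end Hilbert

/-! ### Dirichlet forms on `L²(X; μ)` -/

section Dirichlet

variable {X : Type*} [MeasurableSpace X] {μ : Measure X}

/-- The unit contraction `u ↦ (0 ∨ u) ∧ 1` operates on the form. -/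
def IsMarkovian (F : PartialForm (Lp ℝ 2 μ)) : Prop :=
  ∀ (u : F.dom) (v : Lp ℝ 2 μ),
    (v =ᵐ[μ] fun x => min (max ((u : Lp ℝ 2 μ) x) 0) 1) →
    ∃ hv : v ∈ F.dom, F.form ⟨v, hv⟩ ⟨v, hv⟩ ≤ F.form u u

structure IsSymmetricDirichletForm (F : PartialForm (Lp ℝ 2 μ)) : Prop where
  dense : F.IsDenselyDefined
  symm : F.IsSymmetric
  pos : F.IsPositive
  closed : F.IsClosed
  markov : F.IsMarkovian

/-- Conservativity on a finite measure space: `T_t 1 = 1` for all `t > 0`. -/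
def IsConservative (F : PartialForm (Lp ℝ 2 μ)) : Prop :=
  ∃ e : Lp ℝ 2 μ, (e =ᵐ[μ] fun _ => (1 : ℝ)) ∧ ∀ t : ℝ, 0 < t → F.IsSemigroupValue t e e

variable [TopologicalSpace X]

/-- `dom F ∩ C_c(X)` is dense in `dom F` with respect to `F₁`, and dense in `C_c(X)` with respect
to the supremum norm. -/
def IsRegular (F : PartialForm (Lp ℝ 2 μ)) : Prop :=
  (∀ u : F.dom, ∀ ε > (0 : ℝ), ∃ v : F.dom,
    (∃ g : X → ℝ, Continuous g ∧ HasCompactSupport g ∧ (v : Lp ℝ 2 μ) =ᵐ[μ] g) ∧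
      F.energyOne (u - v) < ε) ∧
  (∀ f : X → ℝ, Continuous f → HasCompactSupport f → ∀ ε > (0 : ℝ), ∃ g : X → ℝ,
    Continuous g ∧ HasCompactSupport g ∧ (∃ v : F.dom, (v : Lp ℝ 2 μ) =ᵐ[μ] g) ∧
      ∀ x, |f x - g x| < ε)

/-- The support of `u ∈ L²(X; μ)`: the support of the measure `|u| μ`. -/
def lpSupport (u : Lp ℝ 2 μ) : Set X := (μ.withDensity fun x => ‖u x‖ₑ).support

/-- `F(u,v) = 0` whenever `u`, `v` have compact support and `v` is constant on a neighbourhood of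
the support of `u`. -/
def IsStronglyLocal (F : PartialForm (Lp ℝ 2 μ)) : Prop :=
  ∀ u v : F.dom, IsCompact (lpSupport (u : Lp ℝ 2 μ)) → IsCompact (lpSupport (v : Lp ℝ 2 μ)) →
    (∃ U : Set X, IsOpen U ∧ lpSupport (u : Lp ℝ 2 μ) ⊆ U ∧
      ∃ c : ℝ, ∀ᵐ x ∂μ.restrict U, (v : Lp ℝ 2 μ) x = c) →
    F.form u v = 0

end Dirichlet

end PartialForm

/-! ### The orthant, its faces and measures -/

/-- `E = [0,∞)ⁿ`, with the trace topology and trace Borel σ-algebra of `ℝⁿ`. -/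
abbrev Orthant (n : ℕ) : Type := {x : Fin n → ℝ // ∀ i, 0 ≤ x i}

namespace Orthant

variable {n : ℕ}

/-- `E₊(B)`: the points whose strictly positive coordinates are exactly those indexed by `B`. -/
def face (B : Finset (Fin n)) : Set (Orthant n) := {x | ∀ i, 0 < x.1 i ↔ i ∈ B}

/-- The interior `(0,∞)ⁿ`, as a subset of `E`. -/
def openOrthant (n : ℕ) : Set (Orthant n) := {x | ∀ i, 0 < x.1 i}

/-- Lebesgue measure on `[0,∞)` in the coordinates of `B`, Dirac measure at `0` in the others. -/
def faceMeasure (B : Finset (Fin n)) : Measure (Orthant n) :=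
  (Measure.pi fun i : Fin n =>
    if i ∈ B then (volume : Measure ℝ).restrict (Set.Ici 0) else Measure.dirac 0).comap
      Subtype.val

/-- `λ_B^{n,s} = s^{n - #B} λ_B^{(n)}`. -/
def scaledFaceMeasure (s : ℝ) (B : Finset (Fin n)) : Measure (Orthant n) :=
  ENNReal.ofReal (s ^ (n - B.card)) • faceMeasure B

/-- `m_{n,s} = ∑_B λ_B^{n,s}`, the sum over all subsets `B` of the index set. -/
def baseMeasure (n : ℕ) (s : ℝ) : Measure (Orthant n) :=
  ∑ B : Finset (Fin n), scaledFaceMeasure s B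

/-- `μ_{n,s,ϱ} = ϱ m_{n,s}`. -/
def refMeasure (s : ℝ) (ϱ : Orthant n → ℝ) : Measure (Orthant n) :=
  (baseMeasure n s).withDensity fun x => ENNReal.ofReal (ϱ x)

/-- `μ_B^{ϱ,n,s} = ϱ λ_B^{n,s}`. -/
def weightedFaceMeasure (s : ℝ) (ϱ : Orthant n → ℝ) (B : Finset (Fin n)) :
    Measure (Orthant n) :=
  (scaledFaceMeasure s B).withDensity fun x => ENNReal.ofReal (ϱ x)

/-- The closed Euclidean ball around `x` of radius `ε` in the closure of `E₊(B)`. -/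
def faceBall (B : Finset (Fin n)) (x : Orthant n) (ε : ℝ) : Set (Orthant n) :=
  {y | y ∈ closure (face B) ∧ Real.sqrt (∑ i, (x.1 i - y.1 i) ^ 2) ≤ ε}

/-- The points of the closure of `E₊(B)` near which `1 / ϱ` is `λ_B^{n,s}`-integrable. -/
def regularSet (s : ℝ) (ϱ : Orthant n → ℝ) (B : Finset (Fin n)) : Set (Orthant n) :=
  {x | x ∈ closure (face B) ∧ ∃ ε > (0 : ℝ),
    ∫⁻ y in faceBall B x ε, (ENNReal.ofReal (ϱ y))⁻¹ ∂(scaledFaceMeasure s B) < ∞}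

/-- The Hamza condition on every face of positive dimension. -/
def HamzaCondition (s : ℝ) (ϱ : Orthant n → ℝ) : Prop :=
  ∀ B : Finset (Fin n), B.Nonempty →
    ∀ᵐ x ∂(scaledFaceMeasure s B), x ∈ closure (face B) \ regularSet s ϱ B → ϱ x = 0

/-! ### The function space `C_c^2(E)` and the form -/

/-- The function on `ℝⁿ` equal to `f` on `E` and to `0` elsewhere; only its restriction to the
open set `(0,∞)ⁿ` is used. -/
def toAmbient (f : Orthant n → ℝ) : (Fin n → ℝ) → ℝ := Function.extend Subtype.val f 0

/-- The partial derivative `∂_i F`. -/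
def partialDeriv (i : Fin n) (F : (Fin n → ℝ) → ℝ) : (Fin n → ℝ) → ℝ :=
  fun x => lineDeriv ℝ F x (Pi.single i 1)

/-- The restriction of `F` to `(0,∞)ⁿ` has a continuous extension to `E`. -/
def ExtendsContinuously (F : (Fin n → ℝ) → ℝ) : Prop :=
  ∃ g : Orthant n → ℝ, Continuous g ∧ ∀ x ∈ openOrthant n, g x = F x.1

/-- `f ∈ C_c^2(E)`: `f` is continuous on `E` with compact support, `C²` in `(0,∞)ⁿ`, and its
partial derivatives of order one and two extend continuously from `(0,∞)ⁿ` to `E`. -/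
structure IsC2c (f : Orthant n → ℝ) : Prop where
  cont : Continuous f
  supp : HasCompactSupport f
  contDiffOn : ContDiffOn ℝ 2 (toAmbient f) {x | ∀ i, 0 < x i}
  ext_one : ∀ i, ExtendsContinuously (partialDeriv i (toAmbient f))
  ext_two : ∀ i j, ExtendsContinuously (partialDeriv i (partialDeriv j (toAmbient f)))

/-- `∂_i f` on all of `E`: the extension by continuity of the partial derivative on `(0,∞)ⁿ`. -/
def pderiv (i : Fin n) (f : Orthant n → ℝ) : Orthant n → ℝ :=
  extendFrom (openOrthant n) fun x => partialDeriv i (toAmbient f) x.1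

/-- `E_B(f,g) = ∑_{i ∈ B} ∫_{E₊(B)} ∂_i f ∂_i g dμ_B^{ϱ,n,s}`. -/
def faceEnergy (s : ℝ) (ϱ : Orthant n → ℝ) (B : Finset (Fin n)) (f g : Orthant n → ℝ) : ℝ :=
  ∑ i ∈ B, ∫ x in face B, pderiv i f x * pderiv i g x ∂(weightedFaceMeasure s ϱ B)

open Classical in
/-- `E(f,g)`: the sum of `E_B(f,g)` over the nonempty subsets `B` of the index set. -/
def energy (s : ℝ) (ϱ : Orthant n → ℝ) (f g : Orthant n → ℝ) : ℝ :=
  ∑ B ∈ Finset.univ.filter (fun B : Finset (Fin n) => B.Nonempty), faceEnergy s ϱ B f g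

/-- `F` is the form `(E, C_c^2(E))` on `L²(E; μ_{n,s,ϱ})`: its domain consists of the classes of
the functions in `C_c^2(E)`, and its value at two classes is `E(f,g)` for any representatives
`f, g ∈ C_c^2(E)`. -/
structure IsEnergyForm (s : ℝ) (ϱ : Orthant n → ℝ)
    (F : PartialForm (Lp ℝ 2 (refMeasure s ϱ))) : Prop where
  memLp : ∀ f : Orthant n → ℝ, IsC2c f → MemLp f 2 (refMeasure s ϱ)
  mem_dom_iff : ∀ u : Lp ℝ 2 (refMeasure s ϱ),
    u ∈ F.dom ↔ ∃ f : Orthant n → ℝ, IsC2c f ∧ u =ᵐ[refMeasure s ϱ] f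
  integrable : ∀ f g : Orthant n → ℝ, IsC2c f → IsC2c g →
    ∀ B : Finset (Fin n), ∀ i ∈ B,
      IntegrableOn (fun x => pderiv i f x * pderiv i g x) (face B) (weightedFaceMeasure s ϱ B)
  form_eq : ∀ (u v : F.dom) (f g : Orthant n → ℝ), IsC2c f → IsC2c g →
    (u : Lp ℝ 2 (refMeasure s ϱ)) =ᵐ[refMeasure s ϱ] f →
    (v : Lp ℝ 2 (refMeasure s ϱ)) =ᵐ[refMeasure s ϱ] g →
    F.form u v = energy s ϱ f g

end Orthant

end

/-!
The form is `‖∇f‖²` for the gradient operator from `L²(E; μ)` to the sum over `i` of the spaces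
`L²({x_i > 0}; μ)`, because a face `E₊(B)` contributes the derivatives `∂_i` with `i ∈ B` only.

It is closable because, by Cauchy-Schwarz, convergence in `L²(ϱ λ_B)` implies convergence in
`L¹(λ_B)` near every point around which `1 / ϱ` is integrable. There one can integrate by parts
along the coordinate lines of the face, which identifies the limit of the gradients of a null
sequence as `0`. Elsewhere on the face `ϱ` vanishes by the Hamza condition.

If `(u, h)` is in the closure and the bounded function `χ` is a pointwise limit of `C¹` functions,
then `χ(u) h` is the gradient of `∫₀ᵘ χ`. With `χ` the indicator of `(0, 1)` this is the Markov
property; with `χ` the indicator of `{c}` it shows that `h` vanishes on `{u = c}`, hence strong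
locality. Finally, dilations of a bump function show that `1` is in the domain with gradient `0`,
so the semigroup fixes it.
-/

noncomputable section

section

variable {E : Type*} [SeminormedAddCommGroup E]

lemma cauchySeq_iff_sq_norm_sub_lt {x : ℕ → E} :
    CauchySeq x ↔ ∀ ε > (0 : ℝ), ∃ N, ∀ k ≥ N, ∀ l ≥ N, ‖x k - x l‖ ^ 2 < ε := by
  rw [Metric.cauchySeq_iff]
  constructor
  · intro h ε hε
    obtain ⟨N, hN⟩ := h √ε (Real.sqrt_pos.2 hε)
    exact ⟨N, fun k hk l hl => (Real.lt_sqrt (norm_nonneg _)).1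
      (dist_eq_norm (x k) (x l) ▸ hN k hk l hl)⟩
  · intro h ε hε
    obtain ⟨N, hN⟩ := h (ε ^ 2) (by positivity)
    exact ⟨N, fun k hk l hl => dist_eq_norm (x k) (x l) ▸
      lt_of_pow_lt_pow_left₀ 2 hε.le (hN k hk l hl)⟩

end

namespace PartialForm

section Operator

variable {H K : Type*} [NormedAddCommGroup H] [InnerProductSpace ℝ H]
  [NormedAddCommGroup K] [InnerProductSpace ℝ K]

/-- The form `(u, v) ↦ ⟪T u, T v⟫` of an unbounded operator `T`. -/
abbrev ofLinearPMap (T : H →ₗ.[ℝ] K) : PartialForm H where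
  dom := T.domain
  form := (innerₗ K).compl₁₂ T.toFun T.toFun

variable {T : H →ₗ.[ℝ] K}

lemma ofLinearPMap_form_apply (u v : T.domain) :
    (ofLinearPMap T).form u v = inner ℝ (T u) (T v) := rfl

lemma isSymmetric_ofLinearPMap (T : H →ₗ.[ℝ] K) : (ofLinearPMap T).IsSymmetric :=
  fun u v => real_inner_comm (T v) (T u)

lemma isPositive_ofLinearPMap (T : H →ₗ.[ℝ] K) : (ofLinearPMap T).IsPositive :=
  fun u => real_inner_self_nonneg (x := T u)

lemma energyOne_ofLinearPMap (u : T.domain) :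
    (ofLinearPMap T).energyOne u = ‖WithLp.toLp 2 ((u : H), T u)‖ ^ 2 := by
  rw [energyOne, ofLinearPMap_form_apply, real_inner_self_eq_norm_sq,
    WithLp.prod_norm_sq_eq_of_L2, add_comm]
  rfl

lemma energyOne_ofLinearPMap_sub (u v : T.domain) :
    (ofLinearPMap T).energyOne (u - v) =
      ‖WithLp.toLp 2 ((u : H), T u) - WithLp.toLp 2 ((v : H), T v)‖ ^ 2 := by
  rw [energyOne_ofLinearPMap, T.map_sub, ← WithLp.toLp_sub, Prod.mk_sub_mk]
  rfl

lemma isClosed_ofLinearPMap [CompleteSpace H] [CompleteSpace K] (hT : T.IsClosed) :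
    (ofLinearPMap T).IsClosed := by
  intro u hu
  simp only [energyOne_ofLinearPMap_sub] at hu
  obtain ⟨p, hp⟩ := cauchySeq_tendsto_of_complete (cauchySeq_iff_sq_norm_sub_lt.2 hu)
  have hgraph : p.ofLp ∈ T.graph :=
    hT.mem_of_tendsto (((WithLp.prod_continuous_ofLp 2 H K).tendsto p).comp hp)
      (.of_forall fun k => T.mem_graph (u k))
  obtain ⟨w, hw, hTw⟩ := T.mem_graph_iff.1 hgraph
  refine ⟨w, ?_⟩
  simp only [energyOne_ofLinearPMap_sub, hw, hTw]
  have hlim := (hp.sub_const p).norm.pow 2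
  rw [sub_self, norm_zero, zero_pow two_ne_zero] at hlim
  exact hlim

lemma isClosable_ofLinearPMap [CompleteSpace K] (hT : T.IsClosable) :
    (ofLinearPMap T).IsClosable := by
  intro u hu hu0
  have hcauchy : CauchySeq fun k => T (u k) := cauchySeq_iff_sq_norm_sub_lt.2 fun ε hε => by
    obtain ⟨N, hN⟩ := hu ε hε
    refine ⟨N, fun k hk l hl => ?_⟩
    rw [← T.map_sub, ← real_inner_self_eq_norm_sq]
    exact hN k hk l hl
  obtain ⟨b, hb⟩ := cauchySeq_tendsto_of_complete hcauchy
  have hgraph : ((0 : H), b) ∈ T.closure.graph := by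
    rw [← hT.graph_closure_eq_closure_graph]
    exact T.graph.isClosed_topologicalClosure.mem_of_tendsto (hu0.prodMk_nhds hb)
      (.of_forall fun k => T.graph.le_topologicalClosure (T.mem_graph (u k)))
  have hb0 : b = 0 := T.closure.graph_fst_eq_zero_snd hgraph rfl
  simpa [hb0] using hb.norm.pow 2

lemma isClosureOf_ofLinearPMap [CompleteSpace H] [CompleteSpace K] (hT : T.IsClosable) :
    (ofLinearPMap T.closure).IsClosureOf (ofLinearPMap T) := by
  have happly (u : T.domain) : T.closure (Submodule.inclusion T.le_closure.1 u) = T u :=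
    (T.le_closure.2 rfl).symm
  refine ⟨isClosed_ofLinearPMap hT.closure_isClosed, T.le_closure.1, fun u v => ?_,
    fun w ε hε => ?_⟩
  · exact congr_arg₂ (inner ℝ) (happly u) (happly v)
  · have hgraph : ((w : H), T.closure w) ∈ T.graph.topologicalClosure := by
      rw [hT.graph_closure_eq_closure_graph]
      exact T.closure.mem_graph w
    let d : H × K → ℝ := fun q =>
      ‖WithLp.toLp 2 ((w : H), T.closure w) - WithLp.toLp 2 q‖ ^ 2
    have hd : Continuous d :=
      ((continuous_const.sub (WithLp.prod_continuous_toLp 2 H K)).norm).pow 2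
    obtain ⟨q, hq, hqT⟩ := mem_closure_iff.1 hgraph {q | d q < ε} (isOpen_lt hd continuous_const)
      (by simpa [d] using hε)
    obtain ⟨u, hu, hTu⟩ := T.mem_graph_iff.1 hqT
    refine ⟨u, ?_⟩
    have hu' : ((Submodule.inclusion T.le_closure.1 u : T.closure.domain) : H) = q.1 := hu
    rw [energyOne_ofLinearPMap_sub, happly, hu', hTu]
    exact hq

end Operator

section Semigroup

variable {H : Type*} [NormedAddCommGroup H] [InnerProductSpace ℝ H] {F : PartialForm H}

lemma IsPositive.resolventValue_unique (hF : F.IsPositive) {β : ℝ} (hβ : 0 < β) {f w w' : H}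
    (hw : F.IsResolventValue β f w) (hw' : F.IsResolventValue β f w') : w = w' := by
  obtain ⟨hd, h⟩ := hw
  obtain ⟨hd', h'⟩ := hw'
  let d : F.dom := ⟨w, hd⟩ - ⟨w', hd'⟩
  have hzero : F.form d d + β * ‖w - w'‖ ^ 2 = 0 := by
    have hsub : F.form ⟨w, hd⟩ d + β * inner ℝ w (w - w') =
        F.form ⟨w', hd'⟩ d + β * inner ℝ w' (w - w') := (h d).trans (h' d).symm
    rw [← real_inner_self_eq_norm_sq, LinearMap.map_sub₂, inner_sub_left]
    linarith
  have hnorm : ‖w - w'‖ ^ 2 = 0 := by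
    nlinarith [hF d, sq_nonneg ‖w - w'‖]
  simpa [sub_eq_zero] using hnorm

lemma IsPositive.resolvent_eq (hF : F.IsPositive) {β : ℝ} (hβ : 0 < β) {f w : H}
    (hw : F.IsResolventValue β f w) : F.resolvent β f = w := by
  have hex : ∃ w, F.IsResolventValue β f w := ⟨w, hw⟩
  rw [resolvent, dif_pos hex]
  exact hF.resolventValue_unique hβ hex.choose_spec hw

lemma IsPositive.smul_resolvent_of_form_eq_zero (hF : F.IsPositive) {e : F.dom}
    (he : ∀ v : F.dom, F.form e v = 0) {β : ℝ} (hβ : 0 < β) :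
    β • F.resolvent β (e : H) = e := by
  have hvalue : F.IsResolventValue β (e : H) (β⁻¹ • (e : H)) := by
    refine ⟨(β⁻¹ • e).2, fun v => ?_⟩
    change F.form (β⁻¹ • e) v + _ = _
    rw [map_smul, LinearMap.smul_apply, he, smul_zero, zero_add, real_inner_smul_left,
      mul_inv_cancel_left₀ hβ.ne']
  rw [hF.resolvent_eq hβ hvalue, smul_inv_smul₀ hβ.ne']

lemma IsPositive.isSemigroupValue_self (hF : F.IsPositive) {e : F.dom}
    (he : ∀ v : F.dom, F.form e v = 0) (t : ℝ) : F.IsSemigroupValue t (e : H) (e : H) := by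
  refine tendsto_const_nhds.congr' ?_
  filter_upwards [eventually_gt_atTop 0] with β hβ
  have hiterate (k : ℕ) : (fun g : H => β • F.resolvent β g)^[k] (e : H) = e :=
    Function.iterate_fixed (hF.smul_resolvent_of_form_eq_zero he hβ) k
  have hexp : HasSum (fun k : ℕ => (t * β) ^ k / (k.factorial : ℝ)) (Real.exp (t * β)) := by
    rw [Real.exp_eq_exp_ℝ]
    exact NormedSpace.expSeries_div_hasSum_exp (t * β)
  simp_rw [semigroupApprox, hiterate]
  rw [(hexp.smul_const (e : H)).tsum_eq, smul_smul, ← Real.exp_add, neg_add_cancel, Real.exp_zero,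
    one_smul]

end Semigroup

end PartialForm

namespace Orthant

variable {n : ℕ}

/-- The open orthant `(0,∞)ⁿ`, as a subset of `ℝⁿ`; `openOrthant n` is the same set in `E`. -/
def posSet (n : ℕ) : Set (Fin n → ℝ) := {x | ∀ i, 0 < x i}

lemma isOpen_posSet : IsOpen (posSet n) := by
  simp only [posSet, Set.ofPred_forall]
  exact isOpen_iInter_of_finite fun i => isOpen_lt continuous_const (continuous_apply i)

lemma isClosed_orthant : IsClosed {x : Fin n → ℝ | ∀ i, 0 ≤ x i} := by
  simp only [Set.ofPred_forall]
  exact isClosed_iInter fun i => isClosed_le continuous_const (continuous_apply i)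

/-- The coordinatewise positive part: a retraction of `ℝⁿ` onto `E`, through which functions on `E`
are evaluated along coordinate lines of `ℝⁿ`. -/
def proj (x : Fin n → ℝ) : Orthant n := ⟨fun i => max (x i) 0, fun _ => le_max_right _ _⟩

lemma continuous_proj : Continuous (proj (n := n)) := by
  unfold proj
  fun_prop

@[simp] lemma proj_coe (x : Orthant n) : proj x.1 = x := by
  ext i
  simp [proj, x.2 i]

lemma coe_proj_of_nonneg {x : Fin n → ℝ} (hx : ∀ i, 0 ≤ x i) : (proj x).1 = x := by
  ext i
  simp [proj, hx i]

lemma coe_proj_of_pos {x : Fin n → ℝ} (hx : x ∈ posSet n) : (proj x).1 = x :=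
  coe_proj_of_nonneg fun i => (hx i).le

@[simp] lemma toAmbient_coe (f : Orthant n → ℝ) (x : Orthant n) : toAmbient f x.1 = f x :=
  Subtype.val_injective.extend_apply _ _ _

lemma toAmbient_of_pos (f : Orthant n → ℝ) {x : Fin n → ℝ} (hx : x ∈ posSet n) :
    toAmbient f x = f (proj x) := by
  conv_lhs => rw [← coe_proj_of_pos hx]
  simp

lemma dense_openOrthant : Dense (openOrthant n) := by
  intro x
  have hc : Continuous fun t : ℝ => proj (fun i => x.1 i + t) := by
    apply continuous_proj.comp
    fun_prop
  have ht : Tendsto (fun t : ℝ => proj (fun i => x.1 i + t)) (𝓝[>] 0) (𝓝 x) := by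
    have := (hc.tendsto 0).mono_left (nhdsWithin_le_nhds (s := Set.Ioi 0))
    simpa using this
  refine mem_closure_of_tendsto ht ?_
  filter_upwards [self_mem_nhdsWithin] with t htp i
  have : 0 < x.1 i + t := add_pos_of_nonneg_of_pos (x.2 i) htp
  simpa [proj] using this

lemma pderiv_eq {f g : Orthant n → ℝ} {i : Fin n} (hg : Continuous g)
    (h : ∀ x ∈ openOrthant n, g x = partialDeriv i (toAmbient f) x.1) : pderiv i f = g := by
  ext x
  refine extendFrom_eq (dense_openOrthant x) ?_
  refine ((hg.tendsto x).mono_left nhdsWithin_le_nhds).congr' ?_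
  filter_upwards [self_mem_nhdsWithin] with y hy using h y hy

lemma IsC2c.continuous_pderiv {f : Orthant n → ℝ} (hf : IsC2c f) (i : Fin n) :
    Continuous (pderiv i f) := by
  obtain ⟨g, hg, h⟩ := hf.ext_one i
  rwa [pderiv_eq hg h]

lemma IsC2c.pderiv_apply {f : Orthant n → ℝ} (hf : IsC2c f) (i : Fin n) {x : Orthant n}
    (hx : x ∈ openOrthant n) : pderiv i f x = partialDeriv i (toAmbient f) x.1 := by
  obtain ⟨g, hg, h⟩ := hf.ext_one i
  rw [pderiv_eq hg h, h x hx]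

lemma partialDeriv_eq_fderiv {F : (Fin n → ℝ) → ℝ} {x : Fin n → ℝ} (hF : DifferentiableAt ℝ F x)
    (i : Fin n) : partialDeriv i F x = fderiv ℝ F x (Pi.single i 1) :=
  hF.lineDeriv_eq_fderiv

lemma partialDeriv_congr {F G : (Fin n → ℝ) → ℝ} (h : Set.EqOn F G (posSet n)) (i : Fin n) :
    Set.EqOn (partialDeriv i F) (partialDeriv i G) (posSet n) := fun _ hx =>
  Filter.EventuallyEq.lineDeriv_eq (h.eventuallyEq_of_mem (isOpen_posSet.mem_nhds hx))

lemma differentiableAt_of_contDiffOn {F : (Fin n → ℝ) → ℝ} {m : WithTop ℕ∞} (hm : m ≠ 0)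
    (hF : ContDiffOn ℝ m F (posSet n)) {x : Fin n → ℝ} (hx : x ∈ posSet n) :
    DifferentiableAt ℝ F x :=
  (hF.contDiffAt (isOpen_posSet.mem_nhds hx)).differentiableAt hm

lemma contDiffOn_partialDeriv {F : (Fin n → ℝ) → ℝ} (hF : ContDiffOn ℝ 2 F (posSet n))
    (i : Fin n) : ContDiffOn ℝ 1 (partialDeriv i F) (posSet n) := by
  have h1 : ContDiffOn ℝ 1 (fun x => fderiv ℝ F x (Pi.single i 1)) (posSet n) :=
    (hF.fderiv_of_isOpen isOpen_posSet (by norm_num [one_add_one_eq_two])).clm_apply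
      contDiffOn_const
  exact h1.congr fun x hx =>
    partialDeriv_eq_fderiv (differentiableAt_of_contDiffOn two_ne_zero hF hx) i

lemma partialDeriv_add {F G : (Fin n → ℝ) → ℝ} {x : Fin n → ℝ} (hF : DifferentiableAt ℝ F x)
    (hG : DifferentiableAt ℝ G x) (i : Fin n) :
    partialDeriv i (F + G) x = partialDeriv i F x + partialDeriv i G x := by
  rw [partialDeriv_eq_fderiv (hF.add hG), partialDeriv_eq_fderiv hF, partialDeriv_eq_fderiv hG,
    fderiv_add hF hG, add_apply]

lemma partialDeriv_mul {F G : (Fin n → ℝ) → ℝ} {x : Fin n → ℝ} (hF : DifferentiableAt ℝ F x)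
    (hG : DifferentiableAt ℝ G x) (i : Fin n) :
    partialDeriv i (F * G) x = F x * partialDeriv i G x + G x * partialDeriv i F x := by
  rw [partialDeriv_eq_fderiv (hF.mul hG), partialDeriv_eq_fderiv hF, partialDeriv_eq_fderiv hG,
    fderiv_mul hF hG]
  simp

lemma partialDeriv_comp {F : (Fin n → ℝ) → ℝ} {φ : ℝ → ℝ} {x : Fin n → ℝ}
    (hF : DifferentiableAt ℝ F x) (hφ : DifferentiableAt ℝ φ (F x)) (i : Fin n) :
    partialDeriv i (φ ∘ F) x = deriv φ (F x) * partialDeriv i F x := by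
  rw [partialDeriv_eq_fderiv (hφ.comp x hF), partialDeriv_eq_fderiv hF, fderiv_comp x hφ hF]
  simp [mul_comm]

lemma isC2c_of_eqOn {f : Orthant n → ℝ} (hc : Continuous f) (hs : HasCompactSupport f)
    (hd : ContDiffOn ℝ 2 (toAmbient f) (posSet n)) (P : Fin n → (Fin n → ℝ) → ℝ)
    (hP : ∀ i, Set.EqOn (partialDeriv i (toAmbient f)) (P i) (posSet n))
    (hP1 : ∀ i, ExtendsContinuously (P i))
    (hP2 : ∀ i j, ExtendsContinuously (partialDeriv i (P j))) : IsC2c f where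
  cont := hc
  supp := hs
  contDiffOn := hd
  ext_one i := by
    obtain ⟨g, hg, h⟩ := hP1 i
    exact ⟨g, hg, fun x hx => (h x hx).trans (hP i hx).symm⟩
  ext_two i j := by
    obtain ⟨g, hg, h⟩ := hP2 i j
    exact ⟨g, hg, fun x hx => (h x hx).trans (partialDeriv_congr (hP j) i hx).symm⟩

lemma IsC2c.differentiableAt {f : Orthant n → ℝ} (hf : IsC2c f) {x : Fin n → ℝ}
    (hx : x ∈ posSet n) : DifferentiableAt ℝ (toAmbient f) x :=
  differentiableAt_of_contDiffOn two_ne_zero hf.contDiffOn hx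

lemma IsC2c.differentiableAt_partialDeriv {f : Orthant n → ℝ} (hf : IsC2c f) (i : Fin n)
    {x : Fin n → ℝ} (hx : x ∈ posSet n) :
    DifferentiableAt ℝ (partialDeriv i (toAmbient f)) x :=
  differentiableAt_of_contDiffOn one_ne_zero (contDiffOn_partialDeriv hf.contDiffOn i) hx

lemma toAmbient_add (f g : Orthant n → ℝ) : toAmbient (f + g) = toAmbient f + toAmbient g := by
  rw [toAmbient, toAmbient, toAmbient, ← Function.extend_add, add_zero]

lemma toAmbient_comp {φ : ℝ → ℝ} (hφ : φ 0 = 0) (f : Orthant n → ℝ) :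
    toAmbient (φ ∘ f) = φ ∘ toAmbient f := by
  ext x
  by_cases hx : ∃ y : Orthant n, y.1 = x
  · obtain ⟨y, rfl⟩ := hx
    simp
  · simp [toAmbient, Function.extend_apply' _ _ _ hx, hφ]

lemma IsC2c.add {f g : Orthant n → ℝ} (hf : IsC2c f) (hg : IsC2c g) : IsC2c (f + g) := by
  refine isC2c_of_eqOn (hf.cont.add hg.cont) (hf.supp.add hg.supp) ?_
    (fun i => partialDeriv i (toAmbient f) + partialDeriv i (toAmbient g)) ?_ ?_ ?_
  · rw [toAmbient_add]
    exact hf.contDiffOn.add hg.contDiffOn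
  · intro i x hx
    rw [toAmbient_add]
    exact partialDeriv_add (hf.differentiableAt hx) (hg.differentiableAt hx) i
  · intro i
    obtain ⟨a, ha, ha'⟩ := hf.ext_one i
    obtain ⟨b, hb, hb'⟩ := hg.ext_one i
    exact ⟨a + b, ha.add hb, fun x hx => by simp [ha' x hx, hb' x hx]⟩
  · intro i j
    obtain ⟨a, ha, ha'⟩ := hf.ext_two i j
    obtain ⟨b, hb, hb'⟩ := hg.ext_two i j
    refine ⟨a + b, ha.add hb, fun x hx => ?_⟩
    rw [partialDeriv_add (hf.differentiableAt_partialDeriv j hx)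
      (hg.differentiableAt_partialDeriv j hx) i]
    simp [ha' x hx, hb' x hx]

lemma IsC2c.comp {f : Orthant n → ℝ} (hf : IsC2c f) {φ : ℝ → ℝ} (hφ : ContDiff ℝ 2 φ)
    (hφ0 : φ 0 = 0) : IsC2c (φ ∘ f) := by
  have hφ' : ContDiff ℝ 1 (deriv φ) := by
    have : ContDiff ℝ (1 + 1) φ := by simpa [one_add_one_eq_two] using hφ
    exact (contDiff_succ_iff_deriv.1 this).2.2
  have hφd : Differentiable ℝ φ := hφ.differentiable two_ne_zero
  have hφd' : Differentiable ℝ (deriv φ) := hφ'.differentiable one_ne_zero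
  refine isC2c_of_eqOn (hφ.continuous.comp hf.cont) (hf.supp.comp_left hφ0) ?_
    (fun i => (deriv φ ∘ toAmbient f) * partialDeriv i (toAmbient f)) ?_ ?_ ?_
  · rw [toAmbient_comp hφ0]
    exact hφ.comp_contDiffOn hf.contDiffOn
  · intro i x hx
    rw [toAmbient_comp hφ0]
    exact partialDeriv_comp (hf.differentiableAt hx) (hφd _) i
  · intro i
    obtain ⟨a, ha, ha'⟩ := hf.ext_one i
    exact ⟨fun x => deriv φ (f x) * a x, (hφ'.continuous.comp hf.cont).mul ha,
      fun x hx => by simp [ha' x hx]⟩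
  · intro i j
    obtain ⟨a, ha, ha'⟩ := hf.ext_two i j
    obtain ⟨b, hb, hb'⟩ := hf.ext_one i
    obtain ⟨c, hc, hc'⟩ := hf.ext_one j
    refine ⟨fun x => deriv φ (f x) * a x + c x * (deriv (deriv φ) (f x) * b x),
      ((hφ'.continuous.comp hf.cont).mul ha).add (hc.mul
        (((hφ'.continuous_deriv le_rfl).comp hf.cont).mul hb)), fun x hx => ?_⟩
    rw [partialDeriv_mul ((hφd' _).comp _ (hf.differentiableAt hx))
      (hf.differentiableAt_partialDeriv j hx) i,
      partialDeriv_comp (hf.differentiableAt hx) (hφd' _) i]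
    simp [ha' x hx, hb' x hx, hc' x hx]

lemma IsC2c.smul {f : Orthant n → ℝ} (hf : IsC2c f) (c : ℝ) : IsC2c (c • f) :=
  hf.comp (φ := fun t => c * t) (by fun_prop) (by simp)

lemma pderiv_add {f g : Orthant n → ℝ} (hf : IsC2c f) (hg : IsC2c g) (i : Fin n) :
    pderiv i (f + g) = pderiv i f + pderiv i g := by
  refine pderiv_eq ((hf.continuous_pderiv i).add (hg.continuous_pderiv i)) fun x hx => ?_
  rw [toAmbient_add, partialDeriv_add (hf.differentiableAt hx) (hg.differentiableAt hx) i]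
  simp [hf.pderiv_apply i hx, hg.pderiv_apply i hx]

lemma pderiv_comp {f : Orthant n → ℝ} (hf : IsC2c f) {φ : ℝ → ℝ} (hφ : ContDiff ℝ 1 φ)
    (hφ0 : φ 0 = 0) (i : Fin n) :
    pderiv i (φ ∘ f) = fun x => deriv φ (f x) * pderiv i f x := by
  refine pderiv_eq (((hφ.continuous_deriv le_rfl).comp hf.cont).mul (hf.continuous_pderiv i))
    fun x hx => ?_
  rw [toAmbient_comp hφ0, partialDeriv_comp (hf.differentiableAt hx)
    (hφ.differentiable one_ne_zero _) i]
  simp [hf.pderiv_apply i hx]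

lemma pderiv_smul {f : Orthant n → ℝ} (hf : IsC2c f) (c : ℝ) (i : Fin n) :
    pderiv i (c • f) = c • pderiv i f := by
  have := pderiv_comp hf (φ := fun t => c * t) (by fun_prop) (by simp) i
  refine Eq.trans this ?_
  ext x
  simp [deriv_const_mul_id']

lemma eqOn_toAmbient_restrict (G : (Fin n → ℝ) → ℝ) :
    Set.EqOn (toAmbient fun x : Orthant n => G x.1) G (posSet n) := fun x hx => by
  rw [toAmbient_of_pos _ hx, coe_proj_of_pos hx]

lemma isC2c_restrict {G : (Fin n → ℝ) → ℝ} (hG : ContDiff ℝ 2 G) (hs : HasCompactSupport G) :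
    IsC2c fun x : Orthant n => G x.1 := by
  have hG' : ∀ j : Fin n, ContDiff ℝ 1 fun x => fderiv ℝ G x (Pi.single j 1) := fun j =>
    (hG.fderiv_right (m := 1) (by norm_num [one_add_one_eq_two])).clm_apply contDiff_const
  refine isC2c_of_eqOn (hG.continuous.comp continuous_subtype_val)
    (hs.comp_isClosedEmbedding isClosed_orthant.isClosedEmbedding_subtypeVal)
    (hG.contDiffOn.congr (eqOn_toAmbient_restrict G))
    (fun i x => fderiv ℝ G x (Pi.single i 1)) (fun i x hx => ?_) (fun i => ?_) (fun i j => ?_)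
  · rw [partialDeriv_congr (eqOn_toAmbient_restrict G) i hx,
      partialDeriv_eq_fderiv (hG.differentiable two_ne_zero x)]
  · exact ⟨fun x => fderiv ℝ G x.1 (Pi.single i 1),
      (hG' i).continuous.comp continuous_subtype_val, fun _ _ => rfl⟩
  · refine ⟨fun x => fderiv ℝ (fun x => fderiv ℝ G x (Pi.single j 1)) x.1 (Pi.single i 1),
      ?_, fun x _ => (partialDeriv_eq_fderiv ((hG' j).differentiable one_ne_zero x.1) i).symm⟩
    exact (((hG' j).continuous_fderiv one_ne_zero).comp continuous_subtype_val).clm_apply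
      continuous_const

lemma IsC2c.zero : IsC2c (0 : Orthant n → ℝ) :=
  isC2c_restrict (G := 0) contDiff_const HasCompactSupport.zero

lemma pderiv_restrict {G : (Fin n → ℝ) → ℝ} (hG : ContDiff ℝ 1 G) (i : Fin n) :
    pderiv i (fun x : Orthant n => G x.1) = fun x => fderiv ℝ G x.1 (Pi.single i 1) := by
  refine pderiv_eq (((hG.continuous_fderiv one_ne_zero).comp continuous_subtype_val).clm_apply
    continuous_const) fun x hx => ?_
  rw [partialDeriv_congr (eqOn_toAmbient_restrict G) i hx,
    partialDeriv_eq_fderiv (hG.differentiable one_ne_zero x.1)]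

lemma pderiv_eq_zero_of_notMem_tsupport {f : Orthant n → ℝ} (i : Fin n) {x : Orthant n}
    (hx : x ∉ tsupport f) : pderiv i f x = 0 := by
  have hU : (tsupport f)ᶜ ∈ 𝓝 x := (isClosed_tsupport f).isOpen_compl.mem_nhds hx
  refine extendFrom_eq (dense_openOrthant x) (tendsto_const_nhds.congr' ?_)
  filter_upwards [self_mem_nhdsWithin,
    mem_nhdsWithin_of_mem_nhds (eventually_mem_nhds_iff.2 hU)] with y hy hyU
  have hzero : toAmbient f =ᶠ[𝓝 y.1] fun _ => 0 := by
    have hproj : Tendsto proj (𝓝 y.1) (𝓝 y) := by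
      simpa only [proj_coe] using continuous_proj.tendsto y.1
    filter_upwards [hproj hyU, isOpen_posSet.mem_nhds hy] with z hz hzpos
    rw [toAmbient_of_pos f hzpos]
    exact image_eq_zero_of_notMem_tsupport hz
  rw [partialDeriv, hzero.lineDeriv_eq]
  simp [lineDeriv]

lemma IsC2c.hasCompactSupport_pderiv {f : Orthant n → ℝ} (hf : IsC2c f) (i : Fin n) :
    HasCompactSupport (pderiv i f) :=
  .intro hf.supp fun _ => pderiv_eq_zero_of_notMem_tsupport i

lemma continuous_proj_update (i : Fin n) :
    Continuous fun p : (Fin n → ℝ) × ℝ => proj (Function.update p.1 i p.2) :=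
  continuous_proj.comp (continuous_fst.update i continuous_snd)

lemma proj_update_proj (x : Fin n → ℝ) (i : Fin n) (t : ℝ) :
    proj (Function.update (proj x).1 i t) = proj (Function.update x i t) := by
  ext j
  rcases eq_or_ne j i with rfl | hj
  · simp [proj]
  · simp [proj, hj]

lemma update_mem_posSet {x : Fin n → ℝ} (hx : x ∈ posSet n) (i : Fin n) {t : ℝ} (ht : 0 < t) :
    Function.update x i t ∈ posSet n := by
  intro j
  rcases eq_or_ne j i with rfl | hj
  · simpa using ht
  · simpa [hj] using hx j

lemma coe_mem_closure_posSet (x : Orthant n) : x.1 ∈ closure (posSet n) :=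
  continuous_subtype_val.closure_preimage_subset (posSet n) (dense_openOrthant x)

namespace IsC2c

variable {f : Orthant n → ℝ}

lemma hasDerivAt_update_of_mem_posSet (hf : IsC2c f) (i : Fin n) {x : Fin n → ℝ}
    (hx : x ∈ posSet n) {t : ℝ} (ht : 0 < t) :
    HasDerivAt (fun r => f (proj (Function.update x i r)))
      (pderiv i f (proj (Function.update x i t))) t := by
  have hxt := update_mem_posSet hx i ht
  have hxt' : proj (Function.update x i t) ∈ openOrthant n := fun j => by
    simpa only [coe_proj_of_pos hxt] using hxt j
  rw [hf.pderiv_apply i hxt', coe_proj_of_pos hxt, partialDeriv_eq_fderiv (hf.differentiableAt hxt)]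
  refine ((hf.differentiableAt hxt).hasFDerivAt.comp_hasDerivAt t
    (hasDerivAt_update x i t)).congr_of_eventuallyEq ?_
  filter_upwards [lt_mem_nhds ht] with r hr
  exact (toAmbient_of_pos f (update_mem_posSet hx i hr)).symm

lemma continuous_pderiv_update (hf : IsC2c f) (i : Fin n) (x : Fin n → ℝ) :
    Continuous fun t : ℝ => pderiv i f (proj (Function.update x i t)) :=
  (hf.continuous_pderiv i).comp ((continuous_proj_update i).comp (.prodMk_right x))

-- Both sides are continuous in `x`, so it suffices to integrate over lines inside `(0,∞)ⁿ`.
lemma integral_pderiv_update (hf : IsC2c f) (i : Fin n) (x : Fin n → ℝ) {a b : ℝ}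
    (ha : 0 < a) (hb : 0 < b) :
    ∫ t in a..b, pderiv i f (proj (Function.update x i t)) =
      f (proj (Function.update x i b)) - f (proj (Function.update x i a)) := by
  have hclosed : IsClosed {x : Fin n → ℝ | ∫ t in a..b, pderiv i f (proj (Function.update x i t)) =
      f (proj (Function.update x i b)) - f (proj (Function.update x i a))} :=
    isClosed_eq
      (intervalIntegral.continuous_parametric_intervalIntegral_of_continuous'
        (f := fun x t => pderiv i f (proj (Function.update x i t)))
        ((hf.continuous_pderiv i).comp (continuous_proj_update i)) a b)
      ((hf.cont.comp ((continuous_proj_update i).comp (.prodMk_left b))).sub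
        (hf.cont.comp ((continuous_proj_update i).comp (.prodMk_left a))))
  have hpos (y : Fin n → ℝ) (hy : y ∈ posSet n) :
      ∫ t in a..b, pderiv i f (proj (Function.update y i t)) =
        f (proj (Function.update y i b)) - f (proj (Function.update y i a)) :=
    intervalIntegral.integral_eq_sub_of_hasDerivAt
      (fun t ht => hf.hasDerivAt_update_of_mem_posSet i hy ((lt_min ha hb).trans_le ht.1))
      ((hf.continuous_pderiv_update i y).intervalIntegrable a b)
  simpa only [Set.mem_ofPred_eq, proj_update_proj] using
    hclosed.closure_subset_iff.2 hpos (coe_mem_closure_posSet (proj x))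

lemma hasDerivAt_update (hf : IsC2c f) (i : Fin n) (x : Fin n → ℝ) {t : ℝ} (ht : 0 < t) :
    HasDerivAt (fun r => f (proj (Function.update x i r)))
      (pderiv i f (proj (Function.update x i t))) t := by
  have hcont := hf.continuous_pderiv_update i x
  refine ((intervalIntegral.integral_hasDerivAt_right (hcont.intervalIntegrable t t)
    (hcont.stronglyMeasurableAtFilter _ _) hcont.continuousAt).const_add
      (f (proj (Function.update x i t)))).congr_of_eventuallyEq ?_
  filter_upwards [lt_mem_nhds ht] with r hr
  rw [hf.integral_pderiv_update i x ht hr]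
  ring

end IsC2c

end Orthant

/-! ### Integral estimates -/

section Integral

variable {X F : Type*} [MeasurableSpace X] {μ : Measure X} [NormedAddCommGroup F]

lemma setLIntegral_enorm_le_eLpNorm_withDensity_mul {w : X → ℝ≥0∞} (hw : AEMeasurable w μ)
    (hw0 : ∀ᵐ x ∂μ, w x ≠ 0) (hwt : ∀ᵐ x ∂μ, w x ≠ ∞) {g : X → F}
    (hg : AEStronglyMeasurable g μ) (K : Set X) :
    ∫⁻ x in K, ‖g x‖ₑ ∂μ ≤
      eLpNorm g 2 (μ.withDensity w) * (∫⁻ x in K, (w x)⁻¹ ∂μ) ^ (1 / 2 : ℝ) := by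
  have rpow_half_sq : ∀ a : ℝ≥0∞, (a ^ (1 / 2 : ℝ)) ^ (2 : ℝ) = a := fun a => by
    rw [← ENNReal.rpow_mul]
    norm_num
  have eLpNorm_eq : eLpNorm g 2 (μ.withDensity w) =
      (∫⁻ x, (‖g x‖ₑ * w x ^ (1 / 2 : ℝ)) ^ (2 : ℝ) ∂μ) ^ (1 / 2 : ℝ) := by
    rw [eLpNorm_eq_lintegral_rpow_enorm_toReal two_ne_zero ENNReal.ofNat_ne_top,
      ENNReal.toReal_ofNat, lintegral_withDensity_eq_lintegral_mul₀ hw (hg.enorm.pow_const _)]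
    simp_rw [ENNReal.mul_rpow_of_nonneg _ _ zero_le_two, rpow_half_sq, Pi.mul_apply, mul_comm]
  calc ∫⁻ x in K, ‖g x‖ₑ ∂μ
      = ∫⁻ x in K, ((fun x => ‖g x‖ₑ * w x ^ (1 / 2 : ℝ)) *
          fun x => (w x)⁻¹ ^ (1 / 2 : ℝ)) x ∂μ := by
        refine lintegral_congr_ae ?_
        filter_upwards [ae_restrict_of_ae hw0, ae_restrict_of_ae hwt] with x h0 ht
        rw [Pi.mul_apply, mul_assoc, ← ENNReal.mul_rpow_of_nonneg _ _ (by norm_num),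
          ENNReal.mul_inv_cancel h0 ht, ENNReal.one_rpow, mul_one]
    _ ≤ (∫⁻ x in K, (‖g x‖ₑ * w x ^ (1 / 2 : ℝ)) ^ (2 : ℝ) ∂μ) ^ (1 / 2 : ℝ) *
          (∫⁻ x in K, ((w x)⁻¹ ^ (1 / 2 : ℝ)) ^ (2 : ℝ) ∂μ) ^ (1 / 2 : ℝ) :=
        ENNReal.lintegral_mul_le_Lp_mul_Lq _ Real.HolderConjugate.two_two
          (hg.enorm.mul (hw.pow_const _)).restrict (hw.inv.pow_const _).restrict
    _ ≤ _ := by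
        simp_rw [eLpNorm_eq, rpow_half_sq]
        gcongr
        exact Measure.restrict_le_self

lemma tendsto_setLIntegral_of_tendsto_eLpNorm_withDensity {ι : Type*} {l : Filter ι}
    {w : X → ℝ≥0∞} (hw : AEMeasurable w μ) (hw0 : ∀ᵐ x ∂μ, w x ≠ 0) (hwt : ∀ᵐ x ∂μ, w x ≠ ∞)
    {K : Set X} (hK : ∫⁻ x in K, (w x)⁻¹ ∂μ ≠ ∞) {g : ι → X → F}
    (hg : ∀ k, AEStronglyMeasurable (g k) μ)
    (hlim : Tendsto (fun k => eLpNorm (g k) 2 (μ.withDensity w)) l (𝓝 0)) :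
    Tendsto (fun k => ∫⁻ x in K, ‖g k x‖ₑ ∂μ) l (𝓝 0) := by
  have hK' := ENNReal.rpow_ne_top_of_nonneg (one_half_pos (α := ℝ)).le hK
  exact tendsto_of_tendsto_of_tendsto_of_le_of_le tendsto_const_nhds
    (by simpa using ENNReal.Tendsto.mul_const hlim (.inr hK')) (fun _ => zero_le)
    fun k => setLIntegral_enorm_le_eLpNorm_withDensity_mul hw hw0 hwt (hg k) K

lemma integrableOn_of_memLp_withDensity {w : X → ℝ≥0∞} (hw : AEMeasurable w μ)
    (hw0 : ∀ᵐ x ∂μ, w x ≠ 0) (hwt : ∀ᵐ x ∂μ, w x ≠ ∞) {K : Set X}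
    (hK : ∫⁻ x in K, (w x)⁻¹ ∂μ ≠ ∞) {g : X → F} (hg : MemLp g 2 (μ.withDensity w)) :
    IntegrableOn g K μ := by
  have hgm := hg.1.mono_ac (withDensity_absolutelyContinuous' hw hw0)
  have hK' := ENNReal.rpow_ne_top_of_nonneg (one_half_pos (α := ℝ)).le hK
  exact ⟨hgm.restrict, (setLIntegral_enorm_le_eLpNorm_withDensity_mul hw hw0 hwt hgm K).trans_lt
    (ENNReal.mul_lt_top hg.2 hK'.lt_top)⟩

lemma tendsto_integral_smul_of_tendsto_setLIntegral [NormedSpace ℝ F] {ι : Type*} {l : Filter ι}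
    {ψ : X → ℝ} (hψ : AEStronglyMeasurable ψ μ) {M : ℝ} (hM : ∀ x, ‖ψ x‖ ≤ M) {U : Set X}
    (hψU : ∀ x ∉ U, ψ x = 0) {g : ι → X → F} {h : X → F} (hg : ∀ᶠ k in l, IntegrableOn (g k) U μ)
    (hh : IntegrableOn h U μ)
    (hlim : Tendsto (fun k => ∫⁻ x in U, ‖g k x - h x‖ₑ ∂μ) l (𝓝 0)) :
    Tendsto (fun k => ∫ x, ψ x • g k x ∂μ) l (𝓝 (∫ x, ψ x • h x ∂μ)) := by
  have setIntegral_eq : ∀ v : X → F, ∫ x, ψ x • v x ∂μ = ∫ x in U, ψ x • v x ∂μ := fun v =>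
    (setIntegral_eq_integral_of_forall_compl_eq_zero fun x hx => by simp [hψU x hx]).symm
  simp_rw [setIntegral_eq]
  refine tendsto_integral_of_L1 _ (hψ.restrict.smul hh.1) ?_ ?_
  · filter_upwards [hg] with k hk using hk.bdd_smul M hψ.restrict (ae_of_all _ hM)
  · refine tendsto_of_tendsto_of_tendsto_of_le_of_le tendsto_const_nhds
      (by simpa using ENNReal.Tendsto.const_mul hlim (.inr (ENNReal.ofReal_ne_top (r := M))))
      (fun _ => zero_le) fun k => ?_
    rw [← lintegral_const_mul' _ _ ENNReal.ofReal_ne_top]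
    refine lintegral_mono fun x => ?_
    rw [Pi.smul_apply', ← smul_sub, enorm_smul, ← ofReal_norm (ψ x)]
    gcongr
    exact hM x

variable {p : ℝ≥0∞}

lemma tendsto_eLpNorm_zero_of_dominated (hp : p ≠ ∞) {f : ℕ → X → F} {G : X → ℝ}
    (hf : ∀ k, AEStronglyMeasurable (f k) μ) (hG : MemLp G p μ)
    (hb : ∀ k, ∀ᵐ x ∂μ, ‖f k x‖ ≤ ‖G x‖) (hlim : ∀ᵐ x ∂μ, Tendsto (fun k => f k x) atTop (𝓝 0)) :
    Tendsto (fun k => eLpNorm (f k) p μ) atTop (𝓝 0) := by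
  rcases eq_or_ne p 0 with rfl | hp0
  · simp
  have hr : 0 < p.toReal := ENNReal.toReal_pos hp0 hp
  simp_rw [eLpNorm_eq_lintegral_rpow_enorm_toReal hp0 hp]
  have h1 : Tendsto (fun k => ∫⁻ x, ‖f k x‖ₑ ^ p.toReal ∂μ) atTop (𝓝 (∫⁻ _, 0 ∂μ)) := by
    refine tendsto_lintegral_of_dominated_convergence' (fun x => ‖G x‖ₑ ^ p.toReal)
      (fun k => (hf k).enorm.pow_const _) (fun k => ?_)
      (lintegral_rpow_enorm_lt_top_of_eLpNorm_lt_top hp0 hp hG.2).ne ?_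
    · filter_upwards [hb k] with x hx
      exact ENNReal.rpow_le_rpow (enorm_le_iff_norm_le.2 hx) hr.le
    · filter_upwards [hlim] with x hx
      simpa [hr, Function.comp_def] using
        (ENNReal.continuous_rpow_const (y := p.toReal)).tendsto 0 |>.comp
          (tendsto_zero_iff_enorm_tendsto_zero.1 hx)
  simpa [hr, Function.comp_def] using
    (ENNReal.continuous_rpow_const (y := 1 / p.toReal)).tendsto _ |>.comp h1

lemma tendsto_eLpNorm_smul_sub [NormedSpace ℝ F] (hp1 : 1 ≤ p) (hp : p ≠ ∞) {a : ℕ → X → ℝ}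
    {b : X → ℝ} {M : ℝ} {g : ℕ → X → F} {h : X → F} (ha : ∀ k, AEStronglyMeasurable (a k) μ)
    (haM : ∀ k x, ‖a k x‖ ≤ M) (hab : ∀ᵐ x ∂μ, Tendsto (fun k => a k x) atTop (𝓝 (b x)))
    (hg : ∀ k, AEStronglyMeasurable (g k) μ) (hh : MemLp h p μ)
    (hgh : Tendsto (fun k => eLpNorm (g k - h) p μ) atTop (𝓝 0)) :
    Tendsto (fun k => eLpNorm (a k • g k - b • h) p μ) atTop (𝓝 0) := by
  have hb : AEStronglyMeasurable b μ := aestronglyMeasurable_of_tendsto_ae atTop ha hab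
  have hbM : ∀ᵐ x ∂μ, ‖b x‖ ≤ M := by
    filter_upwards [hab] with x hx
    exact le_of_tendsto hx.norm (Eventually.of_forall fun k => haM k x)
  have factor_tendsto : Tendsto (fun k => eLpNorm ((a k - b) • h) p μ) atTop (𝓝 0) := by
    refine tendsto_eLpNorm_zero_of_dominated hp (fun k => ((ha k).sub hb).smul hh.1)
      (hh.norm.const_mul (M + M)) (fun k => ?_) ?_
    · filter_upwards [hbM] with x hx
      rw [Pi.smul_apply', norm_smul, norm_mul, norm_norm]
      gcongr
      exact ((norm_sub_le _ _).trans (add_le_add (haM k x) hx)).trans (le_abs_self _)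
    · filter_upwards [hab] with x hx
      simpa using (hx.sub_const (b x)).smul_const (h x)
  have h_tendsto : Tendsto (fun k => eLpNorm (a k • (g k - h)) p μ) atTop (𝓝 0) := by
    refine tendsto_of_tendsto_of_tendsto_of_le_of_le tendsto_const_nhds
      (by simpa using ENNReal.Tendsto.const_mul hgh (.inr (ENNReal.ofReal_ne_top (r := M))))
      (fun _ => zero_le) fun k => eLpNorm_le_mul_eLpNorm_of_ae_le_mul (ae_of_all _ fun x => ?_) p
    rw [Pi.smul_apply', norm_smul]
    gcongr
    exact haM k x
  refine tendsto_of_tendsto_of_tendsto_of_le_of_le tendsto_const_nhds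
    (by simpa using h_tendsto.add factor_tendsto) (fun _ => zero_le) fun k => ?_
  have decomposition : a k • g k - b • h = a k • (g k - h) + (a k - b) • h := by
    rw [smul_sub, sub_smul, sub_add_sub_cancel]
  rw [decomposition]
  exact eLpNorm_add_le ((ha k).smul ((hg k).sub hh.1)) (((ha k).sub hb).smul hh.1) hp1

end Integral

lemma integral_pi_eq_zero_of_forall_update {n : ℕ} {F : Type*} [NormedAddCommGroup F]
    [NormedSpace ℝ F] {α : Fin n → Type*} [∀ i, MeasurableSpace (α i)]
    {μ : ∀ i, Measure (α i)} [∀ i, SigmaFinite (μ i)] {f : (∀ i, α i) → F}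
    (hf : Integrable f (Measure.pi μ)) (i : Fin n)
    (h : ∀ x, ∫ t, f (Function.update x i t) ∂μ i = 0) : ∫ x, f x ∂Measure.pi μ = 0 := by
  cases n with
  | zero => exact i.elim0
  | succ m =>
    have hmp := (measurePreserving_piFinSuccAbove μ i).symm
    rcases isEmpty_or_nonempty (α i) with hα | ⟨⟨a⟩⟩
    · have : IsEmpty (∀ j, α j) := isEmpty_pi.2 ⟨i, hα⟩
      exact integral_of_isEmpty
    have hf' : Integrable (fun z => f ((MeasurableEquiv.piFinSuccAbove α i).symm z)) _ :=
      (hmp.integrable_comp_emb (MeasurableEquiv.measurableEmbedding _)).2 hf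
    rw [← hmp.integral_comp' f, integral_prod_symm _ hf']
    refine integral_eq_zero_of_ae (Eventually.of_forall fun z => ?_)
    have := h (i.insertNth a z)
    simp_rw [Fin.update_insertNth] at this
    simpa [MeasurableEquiv.piFinSuccAbove_symm_apply, Fin.insertNthEquiv] using this

lemma PartialForm.ae_eq_zero_of_notMem_lpSupport {X : Type*} [TopologicalSpace X]
    [HereditarilyLindelofSpace X] [MeasurableSpace X] [OpensMeasurableSpace X] {μ : Measure X}
    (u : Lp ℝ 2 μ) : ∀ᵐ x ∂μ, x ∉ lpSupport u → u x = 0 := by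
  have hm : MeasurableSet (lpSupport u)ᶜ := Measure.isOpen_compl_support.measurableSet
  have h0 : (μ.withDensity fun x => ‖u x‖ₑ) (lpSupport u)ᶜ = 0 := Measure.measure_compl_support
  rw [withDensity_apply _ hm,
    lintegral_eq_zero_iff' (Lp.aestronglyMeasurable u).enorm.restrict] at h0
  filter_upwards [(ae_restrict_iff' hm).1 h0] with x hx hxs
  simpa using hx hxs

/-! ### Primitives -/

section Primitive

/-- The primitive of `ψ` vanishing at `0`. -/
def primitive (ψ : ℝ → ℝ) (t : ℝ) : ℝ := ∫ r in (0 : ℝ)..t, ψ r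

variable {ψ : ℝ → ℝ}

lemma primitive_zero (ψ : ℝ → ℝ) : primitive ψ 0 = 0 := intervalIntegral.integral_same

lemma hasDerivAt_primitive (hψ : Continuous ψ) (t : ℝ) : HasDerivAt (primitive ψ) (ψ t) t :=
  intervalIntegral.integral_hasDerivAt_right (hψ.intervalIntegrable _ _)
    (hψ.stronglyMeasurableAtFilter _ _) hψ.continuousAt

lemma deriv_primitive (hψ : Continuous ψ) : deriv (primitive ψ) = ψ :=
  funext fun t => (hasDerivAt_primitive hψ t).deriv

lemma contDiff_primitive (hψ : ContDiff ℝ 1 ψ) : ContDiff ℝ 2 (primitive ψ) := by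
  rw [← one_add_one_eq_two]
  refine contDiff_succ_iff_deriv.2
    ⟨fun t => (hasDerivAt_primitive hψ.continuous t).differentiableAt, by simp, ?_⟩
  rwa [deriv_primitive hψ.continuous]

lemma abs_primitive_sub_le (hψ : Continuous ψ) {M : ℝ} (hM : ∀ t, |ψ t| ≤ M) (a b : ℝ) :
    |primitive ψ a - primitive ψ b| ≤ M * |a - b| := by
  rw [primitive, primitive, intervalIntegral.integral_interval_sub_left
    (hψ.intervalIntegrable _ _) (hψ.intervalIntegrable _ _)]
  exact intervalIntegral.norm_integral_le_of_norm_le_const (f := ψ) fun x _ => hM x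

lemma abs_primitive_le (hψ : Continuous ψ) {M : ℝ} (hM : ∀ t, |ψ t| ≤ M) (a : ℝ) :
    |primitive ψ a| ≤ M * |a| := by
  simpa [primitive_zero] using abs_primitive_sub_le hψ hM a 0

lemma tendsto_primitive {ψ : ℕ → ℝ → ℝ} {χ : ℝ → ℝ} (hψ : ∀ k, Continuous (ψ k)) {M : ℝ}
    (hM : ∀ k t, |ψ k t| ≤ M) (hχ : ∀ t, Tendsto (fun k => ψ k t) atTop (𝓝 (χ t))) (t : ℝ) :
    Tendsto (fun k => primitive (ψ k) t) atTop (𝓝 (primitive χ t)) :=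
  intervalIntegral.tendsto_integral_filter_of_dominated_convergence (fun _ => M)
    (Eventually.of_forall fun k => (hψ k).aestronglyMeasurable)
    (Eventually.of_forall fun k => ae_of_all _ fun x _ => hM k x) (by simp)
    (ae_of_all _ fun x _ => hχ x)

lemma primitive_indicator_Ioo (t : ℝ) :
    primitive ((Set.Ioo 0 1).indicator 1) t = min (max t 0) 1 := by
  rcases le_total 0 t with ht | ht
  · have inter_eq : Set.Ioc (0 : ℝ) t ∩ Set.Ioc 0 1 = Set.Ioc 0 (min t 1) := by
      rw [Set.Ioc_inter_Ioc, max_self]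
    rw [primitive, intervalIntegral.integral_of_le ht, integral_indicator_one measurableSet_Ioo,
      measureReal_congr Ioo_ae_eq_Ioc, measureReal_restrict_apply' measurableSet_Ioc,
      Set.inter_comm, inter_eq, Real.volume_real_Ioc_of_le (by positivity), max_eq_left ht,
      sub_zero]
  · rw [primitive, intervalIntegral.integral_of_ge ht, max_eq_right ht,
      setIntegral_eq_zero_of_forall_eq_zero]
    · simp
    · exact fun x hx => Set.indicator_of_notMem (fun h => absurd hx.2 (not_le.2 h.1)) _

lemma primitive_indicator_singleton (c t : ℝ) : primitive (({c} : Set ℝ).indicator 1) t = 0 := by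
  refine intervalIntegral.integral_zero_ae ?_
  filter_upwards [compl_mem_ae_iff.2 (measure_singleton (μ := volume) c)] with x hx _
  exact Set.indicator_of_notMem hx _

end Primitive

lemma abs_smoothTransition_le_one (t : ℝ) : |Real.smoothTransition t| ≤ 1 := by
  rw [abs_of_nonneg (Real.smoothTransition.nonneg t)]
  exact Real.smoothTransition.le_one t

lemma tendsto_smoothTransition_nat_mul (a : ℝ) :
    Tendsto (fun k : ℕ => Real.smoothTransition (k * a)) atTop (𝓝 (if 0 < a then 1 else 0)) := by
  split_ifs with ha
  · refine tendsto_const_nhds.congr' ?_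
    filter_upwards [(tendsto_natCast_atTop_atTop.atTop_mul_const ha).eventually_ge_atTop (1 : ℝ)]
      with k hk
    exact (Real.smoothTransition.one_of_one_le hk).symm
  · refine tendsto_const_nhds.congr fun k => ?_
    exact (Real.smoothTransition.zero_of_nonpos
      (mul_nonpos_of_nonneg_of_nonpos (Nat.cast_nonneg k) (not_lt.1 ha))).symm

/-! ### Measures on the faces -/

namespace Orthant

variable {n : ℕ}

/-- The factor of the product measure `faceMeasure B` in the `i`-th coordinate. -/
def coordMeasure (B : Finset (Fin n)) (i : Fin n) : Measure ℝ :=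
  if i ∈ B then (volume : Measure ℝ).restrict (Set.Ici 0) else Measure.dirac 0

instance (B : Finset (Fin n)) (i : Fin n) : SigmaFinite (coordMeasure B i) := by
  unfold coordMeasure
  split_ifs <;> infer_instance

instance (B : Finset (Fin n)) (i : Fin n) : IsLocallyFiniteMeasure (coordMeasure B i) := by
  unfold coordMeasure
  split_ifs <;> infer_instance

lemma faceMeasure_eq (B : Finset (Fin n)) :
    faceMeasure B = (Measure.pi (coordMeasure B)).comap Subtype.val := rfl

lemma ae_coordMeasure (B : Finset (Fin n)) (i : Fin n) :
    ∀ᵐ t ∂coordMeasure B i, 0 ≤ t ∧ (0 < t ↔ i ∈ B) := by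
  unfold coordMeasure
  split_ifs with h
  · rw [← Measure.restrict_congr_set (Ioi_ae_eq_Ici (μ := volume) (a := (0 : ℝ)))]
    filter_upwards [ae_restrict_mem measurableSet_Ioi] with t ht
    exact ⟨le_of_lt ht, by simpa [h] using ht⟩
  · rw [ae_dirac_eq]
    simp [h]

lemma ae_pi_coordMeasure (B : Finset (Fin n)) :
    ∀ᵐ x ∂Measure.pi (coordMeasure B), ∀ i, 0 ≤ x i ∧ (0 < x i ↔ i ∈ B) :=
  ae_all_iff.2 fun i => (Measure.tendsto_eval_ae_ae (i := i)).eventually (ae_coordMeasure B i)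

lemma measurableEmbedding_val : MeasurableEmbedding (Subtype.val : Orthant n → Fin n → ℝ) :=
  MeasurableEmbedding.subtype_coe isClosed_orthant.measurableSet

lemma map_faceMeasure (B : Finset (Fin n)) :
    (faceMeasure B).map Subtype.val = Measure.pi (coordMeasure B) := by
  rw [faceMeasure_eq, measurableEmbedding_val.map_comap]
  refine Measure.restrict_eq_self_of_ae_mem ?_
  filter_upwards [ae_pi_coordMeasure B] with x hx using ⟨⟨x, fun i => (hx i).1⟩, rfl⟩

lemma measurePreserving_val (B : Finset (Fin n)) :
    MeasurePreserving Subtype.val (faceMeasure B) (Measure.pi (coordMeasure B)) :=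
  ⟨measurable_subtype_coe, map_faceMeasure B⟩

instance (B : Finset (Fin n)) : IsFiniteMeasureOnCompacts (faceMeasure B) where
  lt_top_of_isCompact K hK := by
    rw [faceMeasure_eq, measurableEmbedding_val.comap_apply]
    exact (hK.image continuous_subtype_val).measure_lt_top

lemma ae_mem_face (B : Finset (Fin n)) : ∀ᵐ x ∂faceMeasure B, x ∈ face B := by
  have := (measurePreserving_val B).quasiMeasurePreserving.ae (ae_pi_coordMeasure B)
  filter_upwards [this] with x hx i using (hx i).2

lemma measurableSet_pos (i : Fin n) : MeasurableSet {x : Orthant n | 0 < x.1 i} :=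
  measurableSet_lt measurable_const ((measurable_pi_apply i).comp measurable_subtype_coe)

lemma measurableSet_face (B : Finset (Fin n)) : MeasurableSet (face B) := by
  have : face B = ⋂ i, {x : Orthant n | 0 < x.1 i ↔ i ∈ B} := by
    ext x
    simp [face]
  rw [this]
  refine MeasurableSet.iInter fun i => ?_
  by_cases h : i ∈ B
  · simpa [h] using measurableSet_pos i
  · have : {x : Orthant n | 0 < x.1 i ↔ i ∈ B} = {x : Orthant n | 0 < x.1 i}ᶜ := by
      ext x
      simp [h]
    rw [this]
    exact (measurableSet_pos i).compl

lemma disjoint_face {B B' : Finset (Fin n)} (h : B ≠ B') : Disjoint (face B) (face B') := by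
  rw [Set.disjoint_left]
  intro x hx hx'
  exact h (Finset.ext fun i => (hx i).symm.trans (hx' i))

lemma ae_baseMeasure_iff {s : ℝ} {p : Orthant n → Prop} :
    (∀ᵐ x ∂baseMeasure n s, p x) ↔
      ∀ B : Finset (Fin n), ∀ᵐ x ∂scaledFaceMeasure s B, p x := by
  simp only [ae_iff, baseMeasure, Measure.finsetSum_apply, Finset.sum_eq_zero_iff,
    Finset.mem_univ, true_imp_iff]

lemma scaledFaceMeasure_absolutelyContinuous (s : ℝ) (B : Finset (Fin n)) :
    scaledFaceMeasure s B ≪ faceMeasure B := Measure.smul_absolutelyContinuous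

instance (s : ℝ) (B : Finset (Fin n)) : IsFiniteMeasureOnCompacts (scaledFaceMeasure s B) where
  lt_top_of_isCompact _ hK := ENNReal.mul_lt_top ENNReal.ofReal_lt_top hK.measure_lt_top

lemma ae_scaledFaceMeasure_mem_face (s : ℝ) (B : Finset (Fin n)) :
    ∀ᵐ x ∂scaledFaceMeasure s B, x ∈ face B :=
  scaledFaceMeasure_absolutelyContinuous s B (ae_mem_face B)

lemma scaledFaceMeasure_le_baseMeasure (s : ℝ) (B : Finset (Fin n)) :
    scaledFaceMeasure s B ≤ baseMeasure n s := by
  classical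
  rw [baseMeasure, ← Finset.add_sum_erase _ _ (Finset.mem_univ B)]
  exact Measure.le_add_right le_rfl

lemma scaledFaceMeasure_restrict_face {s : ℝ} {B B' : Finset (Fin n)} (h : B ≠ B') :
    (scaledFaceMeasure s B').restrict (face B) = 0 := by
  rw [Measure.restrict_eq_zero]
  refine measure_mono_null ?_ (ae_iff.1 (ae_scaledFaceMeasure_mem_face s B'))
  exact fun x hx => Set.disjoint_left.1 (disjoint_face h) hx

lemma baseMeasure_restrict_face (s : ℝ) (B : Finset (Fin n)) :
    (baseMeasure n s).restrict (face B) = (scaledFaceMeasure s B).restrict (face B) := by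
  ext t ht
  rw [Measure.restrict_apply ht, baseMeasure, Measure.finsetSum_apply,
    Finset.sum_eq_single B, Measure.restrict_apply ht]
  · intro B' _ hB'
    rw [← Measure.restrict_apply ht, scaledFaceMeasure_restrict_face hB'.symm]
    simp
  · simp

lemma refMeasure_restrict_face (s : ℝ) (ϱ : Orthant n → ℝ) (B : Finset (Fin n)) :
    (refMeasure s ϱ).restrict (face B) = (weightedFaceMeasure s ϱ B).restrict (face B) := by
  rw [refMeasure, weightedFaceMeasure, restrict_withDensity (measurableSet_face B),
    restrict_withDensity (measurableSet_face B), baseMeasure_restrict_face]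

lemma isFiniteMeasure_refMeasure {s : ℝ} {ϱ : Orthant n → ℝ}
    (hint : Integrable ϱ (baseMeasure n s)) : IsFiniteMeasure (refMeasure s ϱ) :=
  isFiniteMeasure_withDensity_ofReal hint.2

lemma refMeasure_absolutelyContinuous (s : ℝ) (ϱ : Orthant n → ℝ) :
    refMeasure s ϱ ≪ baseMeasure n s := withDensity_absolutelyContinuous _ _

/-- The restriction of `μ_{n,s,ϱ}` to the faces along which the `i`-th coordinate varies. The terms
of the energy involving `∂_i` add up to a single integral against this measure. -/
def tangentMeasure (s : ℝ) (ϱ : Orthant n → ℝ) (i : Fin n) : Measure (Orthant n) :=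
  (refMeasure s ϱ).restrict {x | 0 < x.1 i}

instance (s : ℝ) (ϱ : Orthant n → ℝ) (i : Fin n) [IsFiniteMeasure (refMeasure s ϱ)] :
    IsFiniteMeasure (tangentMeasure s ϱ i) := by
  unfold tangentMeasure
  infer_instance

lemma tangentMeasure_le (s : ℝ) (ϱ : Orthant n → ℝ) (i : Fin n) :
    tangentMeasure s ϱ i ≤ refMeasure s ϱ := Measure.restrict_le_self

lemma biUnion_face (i : Fin n) :
    ⋃ B ∈ (Finset.univ.filter fun B : Finset (Fin n) => i ∈ B), face B =
      {x : Orthant n | 0 < x.1 i} := by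
  ext x
  simp only [Finset.mem_filter, Finset.mem_univ, true_and, Set.mem_iUnion, exists_prop]
  constructor
  · rintro ⟨B, hi, hx⟩
    exact (hx i).2 hi
  · intro hx
    exact ⟨Finset.univ.filter fun j => 0 < x.1 j, by simpa using hx, fun j => by simp⟩

lemma IsC2c.memLp {f : Orthant n → ℝ} (hf : IsC2c f) (μ : Measure (Orthant n))
    [IsFiniteMeasure μ] : MemLp f 2 μ :=
  hf.cont.memLp_of_hasCompactSupport hf.supp

lemma IsC2c.memLp_pderiv {f : Orthant n → ℝ} (hf : IsC2c f) (i : Fin n) (μ : Measure (Orthant n))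
    [IsFiniteMeasure μ] : MemLp (pderiv i f) 2 μ :=
  (hf.continuous_pderiv i).memLp_of_hasCompactSupport (hf.hasCompactSupport_pderiv i)

lemma IsC2c.integrable_pderiv_mul {f g : Orthant n → ℝ} (hf : IsC2c f) (hg : IsC2c g)
    (i : Fin n) (μ : Measure (Orthant n)) [IsFiniteMeasure μ] :
    Integrable (fun x => pderiv i f x * pderiv i g x) μ :=
  (hf.memLp_pderiv i μ).integrable_mul (hg.memLp_pderiv i μ)

lemma integral_tangentMeasure {s : ℝ} {ϱ : Orthant n → ℝ} {i : Fin n} {v : Orthant n → ℝ}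
    (hv : Integrable v (refMeasure s ϱ)) :
    ∫ x, v x ∂tangentMeasure s ϱ i =
      ∑ B ∈ Finset.univ.filter (fun B : Finset (Fin n) => i ∈ B),
        ∫ x in face B, v x ∂weightedFaceMeasure s ϱ B := by
  rw [tangentMeasure, ← biUnion_face, integral_biUnion_finset _ (fun B _ => measurableSet_face B)
    (fun B _ B' _ h => disjoint_face h) (fun B _ => hv.integrableOn)]
  exact Finset.sum_congr rfl fun B _ => by rw [refMeasure_restrict_face]

lemma energy_eq {s : ℝ} {ϱ : Orthant n → ℝ} [IsFiniteMeasure (refMeasure s ϱ)]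
    {f g : Orthant n → ℝ} (hf : IsC2c f) (hg : IsC2c g) :
    energy s ϱ f g = ∑ i, ∫ x, pderiv i f x * pderiv i g x ∂tangentMeasure s ϱ i := by
  simp_rw [integral_tangentMeasure (hf.integrable_pderiv_mul hg _ _), energy, faceEnergy]
  refine Finset.sum_comm' fun B i => ?_
  simp only [Finset.mem_filter, Finset.mem_univ, true_and, and_true]
  exact ⟨fun h => h.2, fun h => ⟨⟨i, h⟩, h⟩⟩

lemma weightedFaceMeasure_le_tangentMeasure (s : ℝ) (ϱ : Orthant n → ℝ) {B : Finset (Fin n)}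
    {i : Fin n} (hi : i ∈ B) : weightedFaceMeasure s ϱ B ≤ tangentMeasure s ϱ i := by
  have hae : ∀ᵐ x ∂weightedFaceMeasure s ϱ B, x ∈ face B :=
    withDensity_absolutelyContinuous _ _ (ae_scaledFaceMeasure_mem_face s B)
  rw [← Measure.restrict_eq_self_of_ae_mem hae, ← refMeasure_restrict_face, tangentMeasure]
  exact Measure.restrict_mono (fun x hx => (hx i).2 hi) le_rfl

/-! ### Integration by parts on the faces -/

/-- The `i`-th partial derivative `φ ∂_i f + ∂_i φ f` of the product of `φ` and `f`, where `f` and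
`∂_i f` are extended to `ℝⁿ` through `proj`. -/
def productDeriv (φ : (Fin n → ℝ) → ℝ) (f : Orthant n → ℝ) (i : Fin n) (y : Fin n → ℝ) : ℝ :=
  φ y * pderiv i f (proj y) + fderiv ℝ φ y (Pi.single i 1) * f (proj y)

section ProductDeriv

variable {f : Orthant n → ℝ} {φ : (Fin n → ℝ) → ℝ}

lemma continuous_productDeriv (hf : IsC2c f) (hφ : ContDiff ℝ 1 φ) (i : Fin n) :
    Continuous (productDeriv φ f i) :=
  (hφ.continuous.mul ((hf.continuous_pderiv i).comp continuous_proj)).add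
    (((hφ.continuous_fderiv one_ne_zero).clm_apply continuous_const).mul
      (hf.cont.comp continuous_proj))

lemma hasCompactSupport_productDeriv (hs : HasCompactSupport φ) (f : Orthant n → ℝ) (i : Fin n) :
    HasCompactSupport (productDeriv φ f i) :=
  hs.mul_right.add (hs.fderiv_apply ℝ _).mul_right

lemma hasDerivAt_mul_comp_proj_update (hf : IsC2c f) (hφ : ContDiff ℝ 1 φ) (i : Fin n)
    (x : Fin n → ℝ) {t : ℝ} (ht : 0 < t) :
    HasDerivAt (fun t => φ (Function.update x i t) * f (proj (Function.update x i t)))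
      (productDeriv φ f i (Function.update x i t)) t := by
  have hφt : HasDerivAt (fun t => φ (Function.update x i t))
      (fderiv ℝ φ (Function.update x i t) (Pi.single i 1)) t :=
    (hφ.differentiable one_ne_zero _).hasFDerivAt.comp_hasDerivAt t (hasDerivAt_update x i t)
  rw [productDeriv, add_comm]
  exact hφt.mul (hf.hasDerivAt_update i x ht)

lemma integral_coordMeasure_productDeriv (hf : IsC2c f) (hφ : ContDiff ℝ 1 φ)
    (hs : HasCompactSupport φ) {i : Fin n} (hsub : tsupport φ ⊆ {y | 0 < y i})
    {B : Finset (Fin n)} (hi : i ∈ B) (x : Fin n → ℝ) :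
    ∫ t, productDeriv φ f i (Function.update x i t) ∂coordMeasure B i = 0 := by
  have hu : Continuous fun t : ℝ => Function.update x i t := continuous_const.update i continuous_id
  have hue := isClosedEmbedding_update x i
  have hlim : Tendsto (fun t => φ (Function.update x i t) * f (proj (Function.update x i t)))
      atTop (𝓝 0) :=
    (hs.comp_isClosedEmbedding hue).mul_right.is_zero_at_infty.mono_left atTop_le_cocompact
  have hint : Integrable fun t => productDeriv φ f i (Function.update x i t) :=
    ((continuous_productDeriv hf hφ i).comp hu).integrable_of_hasCompactSupport
      ((hasCompactSupport_productDeriv hs f i).comp_isClosedEmbedding hue)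
  have h0 : φ (Function.update x i 0) = 0 :=
    image_eq_zero_of_notMem_tsupport fun h => by simpa using hsub h
  rw [coordMeasure, if_pos hi, ← Measure.restrict_congr_set (Ioi_ae_eq_Ici (μ := volume)),
    integral_Ioi_of_hasDerivAt_of_tendsto
      ((hφ.continuous.comp hu).mul
        (hf.cont.comp (continuous_proj.comp hu))).continuousWithinAt
      (fun t ht => hasDerivAt_mul_comp_proj_update hf hφ i x ht) hint.integrableOn hlim]
  simp [h0]

lemma integral_mul_pderiv (hf : IsC2c f) (hφ : ContDiff ℝ 1 φ) (hs : HasCompactSupport φ)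
    {i : Fin n} (hsub : tsupport φ ⊆ {y | 0 < y i}) (s : ℝ) {B : Finset (Fin n)} (hi : i ∈ B) :
    ∫ x, φ x.1 * pderiv i f x ∂scaledFaceMeasure s B =
      -∫ x, fderiv ℝ φ x.1 (Pi.single i 1) * f x ∂scaledFaceMeasure s B := by
  have hem := isClosed_orthant (n := n) |>.isClosedEmbedding_subtypeVal
  have hint : Integrable (fun x : Orthant n => φ x.1 * pderiv i f x) (faceMeasure B) :=
    ((hφ.continuous.comp continuous_subtype_val).mul
      (hf.continuous_pderiv i)).integrable_of_hasCompactSupport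
      (hs.comp_isClosedEmbedding hem).mul_right
  have hint' : Integrable (fun x : Orthant n => fderiv ℝ φ x.1 (Pi.single i 1) * f x)
      (faceMeasure B) :=
    ((((hφ.continuous_fderiv one_ne_zero).clm_apply continuous_const).comp
      continuous_subtype_val).mul hf.cont).integrable_of_hasCompactSupport
      ((hs.fderiv_apply ℝ _).comp_isClosedEmbedding hem).mul_right
  have hpi : ∫ y, productDeriv φ f i y ∂Measure.pi (coordMeasure B) = 0 :=
    integral_pi_eq_zero_of_forall_update ((continuous_productDeriv hf hφ
      i).integrable_of_hasCompactSupport (hasCompactSupport_productDeriv hs f i)) i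
      (integral_coordMeasure_productDeriv hf hφ hs hsub hi)
  rw [← map_faceMeasure, measurableEmbedding_val.integral_map] at hpi
  simp only [productDeriv, proj_coe] at hpi
  rw [scaledFaceMeasure, integral_smul_measure, integral_smul_measure, ← smul_neg,
    eq_neg_of_add_eq_zero_left ((integral_add hint hint').symm.trans hpi)]

end ProductDeriv

end Orthant

/-! ### Closability -/

namespace Orthant

variable {n : ℕ} {s : ℝ} {ϱ : Orthant n → ℝ} {B : Finset (Fin n)} {i : Fin n}
  {h : Orthant n → ℝ}

section Filter

variable {ι : Type*} {l : Filter ι} [l.NeBot] {f : ι → Orthant n → ℝ}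

lemma integral_mul_eq_zero_of_tendsto_pderiv (hi : i ∈ B) {V : Set (Fin n → ℝ)}
    (hV : V ⊆ {y | 0 < y i}) (hf : ∀ k, IsC2c (f k))
    (hh : IntegrableOn h (Subtype.val ⁻¹' V) (scaledFaceMeasure s B))
    (hf0 : Tendsto (fun k => ∫⁻ x in Subtype.val ⁻¹' V, ‖f k x‖ₑ ∂scaledFaceMeasure s B) l (𝓝 0))
    (hfh : Tendsto (fun k => ∫⁻ x in Subtype.val ⁻¹' V, ‖pderiv i (f k) x - h x‖ₑ
      ∂scaledFaceMeasure s B) l (𝓝 0))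
    {φ : (Fin n → ℝ) → ℝ} (hφ : ContDiff ℝ 1 φ) (hφs : HasCompactSupport φ)
    (hφV : tsupport φ ⊆ V) : ∫ x, φ x.1 * h x ∂scaledFaceMeasure s B = 0 := by
  have hφd : Continuous fun y => fderiv ℝ φ y (Pi.single i 1) :=
    (hφ.continuous_fderiv one_ne_zero).clm_apply continuous_const
  obtain ⟨M, hM⟩ := hφs.exists_bound_of_continuous hφ.continuous
  obtain ⟨M', hM'⟩ := (hφs.fderiv_apply ℝ (Pi.single i 1)).exists_bound_of_continuous hφd
  have hφ0 : ∀ x ∉ Subtype.val ⁻¹' V, φ (x : Orthant n).1 = 0 := fun x hx =>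
    image_eq_zero_of_notMem_tsupport fun hx' => hx (hφV hx')
  have hφd0 : ∀ x ∉ Subtype.val ⁻¹' V, fderiv ℝ φ (x : Orthant n).1 (Pi.single i 1) = 0 :=
    fun x hx => by
      rw [fderiv_of_notMem_tsupport ℝ fun hx' => hx (hφV hx'), zero_apply]
  have tendsto_left : Tendsto (fun k => ∫ x, φ x.1 * pderiv i (f k) x ∂scaledFaceMeasure s B) l
      (𝓝 (∫ x, φ x.1 * h x ∂scaledFaceMeasure s B)) :=
    tendsto_integral_smul_of_tendsto_setLIntegral
      (hφ.continuous.comp continuous_subtype_val).aestronglyMeasurable (fun x => hM x.1) hφ0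
      (Eventually.of_forall fun k => (((hf k).continuous_pderiv i).integrable_of_hasCompactSupport
        ((hf k).hasCompactSupport_pderiv i)).integrableOn) hh hfh
  have tendsto_right : Tendsto (fun k => ∫ x, fderiv ℝ φ x.1 (Pi.single i 1) * f k x
      ∂scaledFaceMeasure s B) l (𝓝 0) := by
    simpa using tendsto_integral_smul_of_tendsto_setLIntegral (h := 0)
      (hφd.comp continuous_subtype_val).aestronglyMeasurable (fun x => hM' x.1) hφd0
      (Eventually.of_forall fun k => ((hf k).cont.integrable_of_hasCompactSupport
        (hf k).supp).integrableOn) integrableOn_zero (by simpa using hf0)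
  refine tendsto_nhds_unique tendsto_left ?_
  simp_rw [fun k => integral_mul_pderiv (hf k) hφ hφs (hφV.trans hV) s hi]
  simpa using tendsto_right.neg

lemma ae_eq_zero_of_tendsto_pderiv (hi : i ∈ B) {V : Set (Fin n → ℝ)} (hVo : IsOpen V)
    (hV : V ⊆ {y | 0 < y i}) (hf : ∀ k, IsC2c (f k))
    (hh : IntegrableOn h (Subtype.val ⁻¹' V) (scaledFaceMeasure s B))
    (hf0 : Tendsto (fun k => ∫⁻ x in Subtype.val ⁻¹' V, ‖f k x‖ₑ ∂scaledFaceMeasure s B) l (𝓝 0))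
    (hfh : Tendsto (fun k => ∫⁻ x in Subtype.val ⁻¹' V, ‖pderiv i (f k) x - h x‖ₑ
      ∂scaledFaceMeasure s B) l (𝓝 0)) :
    ∀ᵐ x ∂scaledFaceMeasure s B, x.1 ∈ V → h x = 0 := by
  have ae_map : ∀ᵐ y ∂(scaledFaceMeasure s B).map Subtype.val, y ∈ V → h (proj y) = 0 := by
    refine hVo.ae_eq_zero_of_integral_contDiff_smul_eq_zero ?_ fun φ hφ hφs hφV => ?_
    · refine IntegrableOn.locallyIntegrableOn ?_
      rw [measurableEmbedding_val.integrableOn_map_iff]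
      exact hh.congr_fun_ae (ae_of_all _ fun x => by simp)
    · rw [measurableEmbedding_val.integral_map]
      simpa using integral_mul_eq_zero_of_tendsto_pderiv hi hV hf hh hf0 hfh
        (hφ.of_le (mod_cast le_top)) hφs hφV
  simpa [measurableEmbedding_val.ae_map_iff] using ae_map

end Filter

lemma isOpen_euclideanBall (x : Fin n → ℝ) (ε : ℝ) :
    IsOpen {y : Fin n → ℝ | Real.sqrt (∑ j, (x j - y j) ^ 2) < ε} :=
  isOpen_lt (by fun_prop) continuous_const

variable {f : ℕ → Orthant n → ℝ}

lemma ae_eq_zero_near_of_tendsto_pderiv (hϱ : AEMeasurable ϱ (scaledFaceMeasure s B))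
    (hpos : ∀ᵐ x ∂scaledFaceMeasure s B, 0 < ϱ x) (hi : i ∈ B) (hf : ∀ k, IsC2c (f k))
    (hh : MemLp h 2 (weightedFaceMeasure s ϱ B))
    (hf0 : Tendsto (fun k => eLpNorm (f k) 2 (weightedFaceMeasure s ϱ B)) atTop (𝓝 0))
    (hfh : Tendsto (fun k => eLpNorm (pderiv i (f k) - h) 2 (weightedFaceMeasure s ϱ B)) atTop
      (𝓝 0)) {x₀ : Orthant n} {ε : ℝ}
    (hfin : ∫⁻ y in faceBall B x₀ ε, (ENNReal.ofReal (ϱ y))⁻¹ ∂scaledFaceMeasure s B < ∞) :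
    ∀ᵐ x ∂scaledFaceMeasure s B, Real.sqrt (∑ j, (x₀.1 j - x.1 j) ^ 2) < ε → h x = 0 := by
  have hw := hϱ.ennreal_ofReal
  have hw0 : ∀ᵐ x ∂scaledFaceMeasure s B, ENNReal.ofReal (ϱ x) ≠ 0 := by
    filter_upwards [hpos] with x hx using (ENNReal.ofReal_pos.2 hx).ne'
  have hwt : ∀ᵐ x ∂scaledFaceMeasure s B, ENNReal.ofReal (ϱ x) ≠ ∞ :=
    ae_of_all _ fun _ => ENNReal.ofReal_ne_top
  have hhm := hh.1.mono_ac (withDensity_absolutelyContinuous' hw hw0)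
  set V : Set (Fin n → ℝ) :=
    {y | Real.sqrt (∑ j, (x₀.1 j - y j) ^ 2) < ε} ∩ {y | 0 < y i}
  have hVo : IsOpen V :=
    (isOpen_euclideanBall _ _).inter (isOpen_lt continuous_const (continuous_apply i))
  have preimage_le : (Subtype.val ⁻¹' V : Set (Orthant n)) ≤ᵐ[scaledFaceMeasure s B]
      faceBall B x₀ ε := by
    filter_upwards [ae_scaledFaceMeasure_mem_face s B] with x hx hxV
    exact ⟨subset_closure hx, hxV.1.le⟩
  have tendsto_setLIntegral : ∀ g : ℕ → Orthant n → ℝ,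
      (∀ k, AEStronglyMeasurable (g k) (scaledFaceMeasure s B)) →
      Tendsto (fun k => eLpNorm (g k) 2 (weightedFaceMeasure s ϱ B)) atTop (𝓝 0) →
      Tendsto (fun k => ∫⁻ x in Subtype.val ⁻¹' V, ‖g k x‖ₑ ∂scaledFaceMeasure s B) atTop
        (𝓝 0) := fun g hg hg0 =>
    tendsto_of_tendsto_of_tendsto_of_le_of_le tendsto_const_nhds
      (tendsto_setLIntegral_of_tendsto_eLpNorm_withDensity hw hw0 hwt hfin.ne hg hg0)
      (fun _ => zero_le) fun _ => lintegral_mono_set' preimage_le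
  have ae_V := ae_eq_zero_of_tendsto_pderiv hi hVo Set.inter_subset_right hf
    ((integrableOn_of_memLp_withDensity hw hw0 hwt hfin.ne hh).mono_set_ae preimage_le)
    (tendsto_setLIntegral f (fun k => (hf k).cont.aestronglyMeasurable) hf0)
    (tendsto_setLIntegral _ (fun k => ((hf k).continuous_pderiv i).aestronglyMeasurable.sub hhm)
      hfh)
  filter_upwards [ae_V, ae_scaledFaceMeasure_mem_face s B] with x hx hxB hlt
  exact hx ⟨hlt, (hxB i).2 hi⟩

lemma HamzaCondition.ae_mem_regularSet (hH : HamzaCondition s ϱ) (hB : B.Nonempty)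
    (hpos : ∀ᵐ x ∂scaledFaceMeasure s B, 0 < ϱ x) :
    ∀ᵐ x ∂scaledFaceMeasure s B, x ∈ regularSet s ϱ B := by
  filter_upwards [hH B hB, ae_scaledFaceMeasure_mem_face s B, hpos] with x hx hxB hxpos
  by_contra hreg
  exact hxpos.ne' (hx ⟨subset_closure hxB, hreg⟩)

lemma HamzaCondition.ae_scaledFaceMeasure_eq_zero (hH : HamzaCondition s ϱ)
    (hϱ : AEMeasurable ϱ (scaledFaceMeasure s B)) (hpos : ∀ᵐ x ∂scaledFaceMeasure s B, 0 < ϱ x)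
    (hi : i ∈ B) (hf : ∀ k, IsC2c (f k)) (hh : MemLp h 2 (weightedFaceMeasure s ϱ B))
    (hf0 : Tendsto (fun k => eLpNorm (f k) 2 (weightedFaceMeasure s ϱ B)) atTop (𝓝 0))
    (hfh : Tendsto (fun k => eLpNorm (pderiv i (f k) - h) 2 (weightedFaceMeasure s ϱ B)) atTop
      (𝓝 0)) : h =ᵐ[scaledFaceMeasure s B] 0 := by
  have locally_null : scaledFaceMeasure s B {x | x ∈ regularSet s ϱ B ∧ h x ≠ 0} = 0 := by
    refine measure_null_of_locally_null _ fun x₀ hx₀ => ?_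
    obtain ⟨-, ε, hε, hfin⟩ := hx₀.1
    refine ⟨{x | Real.sqrt (∑ j, (x₀.1 j - x.1 j) ^ 2) < ε} ∩
      {x | x ∈ regularSet s ϱ B ∧ h x ≠ 0}, inter_mem (mem_nhdsWithin_of_mem_nhds ?_)
        self_mem_nhdsWithin, ?_⟩
    · exact ((isOpen_euclideanBall x₀.1 ε).preimage continuous_subtype_val).mem_nhds
        (by simpa using hε)
    · have hnear := ae_eq_zero_near_of_tendsto_pderiv hϱ hpos hi hf hh hf0 hfh hfin
      refine measure_mono_null (fun x hx => ?_) (ae_iff.1 hnear)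
      exact fun hx0 => hx.2.2 (hx0 hx.1)
  filter_upwards [hH.ae_mem_regularSet ⟨i, hi⟩ hpos, compl_mem_ae_iff.2 locally_null]
    with x hreg hx
  by_contra hx0
  exact hx ⟨hreg, hx0⟩

lemma HamzaCondition.ae_tangentMeasure_eq_zero (hH : HamzaCondition s ϱ)
    (hϱ : AEMeasurable ϱ (baseMeasure n s)) (hpos : ∀ᵐ x ∂baseMeasure n s, 0 < ϱ x)
    (hf : ∀ k, IsC2c (f k)) (hh : MemLp h 2 (tangentMeasure s ϱ i))
    (hf0 : Tendsto (fun k => eLpNorm (f k) 2 (refMeasure s ϱ)) atTop (𝓝 0))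
    (hfh : Tendsto (fun k => eLpNorm (pderiv i (f k) - h) 2 (tangentMeasure s ϱ i)) atTop (𝓝 0)) :
    h =ᵐ[tangentMeasure s ϱ i] 0 := by
  refine (ae_restrict_iff' (measurableSet_pos i)).2 (refMeasure_absolutelyContinuous s ϱ
    (ae_baseMeasure_iff.2 fun B => ?_))
  by_cases hi : i ∈ B
  · have hle := weightedFaceMeasure_le_tangentMeasure s ϱ hi
    have tendsto_face : ∀ {g : ℕ → Orthant n → ℝ} {μ : Measure (Orthant n)},
        weightedFaceMeasure s ϱ B ≤ μ → Tendsto (fun k => eLpNorm (g k) 2 μ) atTop (𝓝 0) →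
        Tendsto (fun k => eLpNorm (g k) 2 (weightedFaceMeasure s ϱ B)) atTop (𝓝 0) :=
      fun hμ hg => tendsto_of_tendsto_of_tendsto_of_le_of_le tendsto_const_nhds hg
        (fun _ => zero_le) fun _ => eLpNorm_mono_measure _ hμ
    filter_upwards [hH.ae_scaledFaceMeasure_eq_zero
      (hϱ.mono_measure (scaledFaceMeasure_le_baseMeasure s B)) (ae_baseMeasure_iff.1 hpos B) hi hf
      (hh.mono_measure hle) (tendsto_face (hle.trans (tangentMeasure_le s ϱ i)) hf0)
      (tendsto_face hle hfh)] with x hx _ using hx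
  · filter_upwards [ae_scaledFaceMeasure_mem_face s B] with x hx hxi
    exact absurd ((hx i).1 hxi) hi

end Orthant

/-! ### Gradients as limits of smooth gradients -/

namespace Orthant

variable {n : ℕ} {s : ℝ} {ϱ : Orthant n → ℝ}

/-- `h` is a gradient of `u` in the strong sense: `(u, h)` is a limit of pairs `(f, ∇ f)` with
`f ∈ C_c^2(E)`, where the functions converge in `L²` of the reference measure and the `i`-th
derivatives in `L²` of its restriction to `{x_i > 0}`. -/
structure HasGradient (s : ℝ) (ϱ : Orthant n → ℝ) (u : Orthant n → ℝ)
    (h : Fin n → Orthant n → ℝ) : Prop where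
  memLp : MemLp u 2 (refMeasure s ϱ)
  memLp_grad : ∀ i, MemLp (h i) 2 (tangentMeasure s ϱ i)
  approx : ∀ ε > (0 : ℝ≥0∞), ∃ f : Orthant n → ℝ, IsC2c f ∧
    eLpNorm (f - u) 2 (refMeasure s ϱ) < ε ∧
    ∀ i, eLpNorm (pderiv i f - h i) 2 (tangentMeasure s ϱ i) < ε

/-- Closability of the gradient on `C_c^2(E)`: gradients in the sense of `HasGradient` are
determined by the function. -/
def HasClosableGradient (s : ℝ) (ϱ : Orthant n → ℝ) : Prop :=
  ∀ ⦃u h⦄, HasGradient s ϱ u h → u =ᵐ[refMeasure s ϱ] 0 → ∀ i, h i =ᵐ[tangentMeasure s ϱ i] 0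

lemma IsC2c.hasGradient [IsFiniteMeasure (refMeasure s ϱ)] {f : Orthant n → ℝ} (hf : IsC2c f) :
    HasGradient s ϱ f fun i => pderiv i f where
  memLp := hf.memLp _
  memLp_grad i := hf.memLp_pderiv i _
  approx ε hε := ⟨f, hf, by simpa using hε, fun i => by simpa using hε⟩

namespace HasGradient

variable {u : Orthant n → ℝ} {h : Fin n → Orthant n → ℝ}

lemma exists_seq (H : HasGradient s ϱ u h) : ∃ f : ℕ → Orthant n → ℝ, (∀ k, IsC2c (f k)) ∧
    Tendsto (fun k => eLpNorm (f k - u) 2 (refMeasure s ϱ)) atTop (𝓝 0) ∧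
    ∀ i, Tendsto (fun k => eLpNorm (pderiv i (f k) - h i) 2 (tangentMeasure s ϱ i)) atTop
      (𝓝 0) := by
  obtain ⟨ε, -, hε, hε0⟩ := exists_seq_strictAnti_tendsto' (zero_lt_one' ℝ≥0∞)
  choose f hf hfu hfh using fun k => H.approx (ε k) (hε k).1
  have tendsto_zero_of_lt : ∀ {r : ℕ → ℝ≥0∞}, (∀ k, r k < ε k) → Tendsto r atTop (𝓝 0) :=
    fun hr => tendsto_of_tendsto_of_tendsto_of_le_of_le tendsto_const_nhds hε0
      (fun _ => zero_le) fun k => (hr k).le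
  exact ⟨f, hf, tendsto_zero_of_lt hfu, fun i => tendsto_zero_of_lt fun k => hfh k i⟩

lemma congr {u' : Orthant n → ℝ} {h' : Fin n → Orthant n → ℝ} (H : HasGradient s ϱ u h)
    (hu : u =ᵐ[refMeasure s ϱ] u') (hh : ∀ i, h i =ᵐ[tangentMeasure s ϱ i] h' i) :
    HasGradient s ϱ u' h' where
  memLp := (memLp_congr_ae hu).1 H.memLp
  memLp_grad i := (memLp_congr_ae (hh i)).1 (H.memLp_grad i)
  approx ε hε := by
    obtain ⟨f, hf, hfu, hfh⟩ := H.approx ε hε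
    refine ⟨f, hf, ?_, fun i => ?_⟩
    · rwa [← eLpNorm_congr_ae (EventuallyEq.rfl.sub hu)]
    · rw [← eLpNorm_congr_ae (EventuallyEq.rfl.sub (hh i))]
      exact hfh i

lemma of_tendsto {u : ℕ → Orthant n → ℝ} {h : ℕ → Fin n → Orthant n → ℝ}
    (H : ∀ k, HasGradient s ϱ (u k) (h k)) {v : Orthant n → ℝ} {g : Fin n → Orthant n → ℝ}
    (hv : MemLp v 2 (refMeasure s ϱ)) (hg : ∀ i, MemLp (g i) 2 (tangentMeasure s ϱ i))
    (huv : Tendsto (fun k => eLpNorm (u k - v) 2 (refMeasure s ϱ)) atTop (𝓝 0))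
    (hhg : ∀ i, Tendsto (fun k => eLpNorm (h k i - g i) 2 (tangentMeasure s ϱ i)) atTop (𝓝 0)) :
    HasGradient s ϱ v g where
  memLp := hv
  memLp_grad := hg
  approx ε hε := by
    have hε2 : 0 < ε / 2 := ENNReal.half_pos hε.ne'
    have sub_lt : ∀ {μ : Measure (Orthant n)} {a b c : Orthant n → ℝ},
        AEStronglyMeasurable a μ → AEStronglyMeasurable b μ → AEStronglyMeasurable c μ →
        eLpNorm (a - b) 2 μ < ε / 2 → eLpNorm (b - c) 2 μ < ε / 2 → eLpNorm (a - c) 2 μ < ε := by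
      intro μ a b c ha hb hc hab hbc
      calc eLpNorm (a - c) 2 μ = eLpNorm ((a - b) + (b - c)) 2 μ := by rw [sub_add_sub_cancel]
        _ ≤ eLpNorm (a - b) 2 μ + eLpNorm (b - c) 2 μ :=
          eLpNorm_add_le (ha.sub hb) (hb.sub hc) one_le_two
        _ < ε / 2 + ε / 2 := ENNReal.add_lt_add hab hbc
        _ = ε := ENNReal.add_halves ε
    obtain ⟨k, hkv, hkg⟩ := ((huv.eventually_lt_const hε2).and
      (eventually_all.2 fun i => (hhg i).eventually_lt_const hε2)).exists
    obtain ⟨f, hf, hfu, hfh⟩ := (H k).approx (ε / 2) hε2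
    exact ⟨f, hf, sub_lt hf.cont.aestronglyMeasurable (H k).memLp.1 hv.1 hfu hkv, fun i =>
      sub_lt (hf.continuous_pderiv i).aestronglyMeasurable ((H k).memLp_grad i).1 (hg i).1
        (hfh i) (hkg i)⟩

variable [IsFiniteMeasure (refMeasure s ϱ)] {M : ℝ}

lemma comp_primitive (H : HasGradient s ϱ u h) {ψ : ℝ → ℝ} (hψ : ContDiff ℝ 1 ψ)
    (hM : ∀ t, |ψ t| ≤ M) :
    HasGradient s ϱ (fun x => primitive ψ (u x)) fun i x => ψ (u x) * h i x := by
  obtain ⟨f, hf, hfu, hfh⟩ := H.exists_seq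
  obtain ⟨ns, hns, hae⟩ := (tendstoInMeasure_of_tendsto_eLpNorm two_ne_zero
    (fun k => (hf k).cont.aestronglyMeasurable) H.memLp.1 hfu).exists_seq_tendsto_ae
  have hP := contDiff_primitive hψ
  have hψu : AEStronglyMeasurable (fun x => ψ (u x)) (refMeasure s ϱ) :=
    hψ.continuous.comp_aestronglyMeasurable H.memLp.1
  have pderiv_primitive_comp : ∀ k i, pderiv i (primitive ψ ∘ f (ns k)) =
      fun x => ψ (f (ns k) x) * pderiv i (f (ns k)) x := fun k i => by
    rw [pderiv_comp (hf _) (hP.of_le one_le_two) (primitive_zero ψ),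
      deriv_primitive hψ.continuous]
  refine of_tendsto (fun k => ((hf (ns k)).comp hP (primitive_zero ψ)).hasGradient)
    (H.memLp.of_le_mul (hP.continuous.comp_aestronglyMeasurable H.memLp.1)
      (ae_of_all _ fun x => abs_primitive_le hψ.continuous hM _))
    (fun i => (H.memLp_grad i).of_le_mul (c := M) (hψu.restrict.mul (H.memLp_grad i).1)
      (ae_of_all _ fun x => ?_)) ?_ fun i => ?_
  · rw [norm_mul]
    exact mul_le_mul_of_nonneg_right (hM _) (norm_nonneg _)
  · have hfuM := ENNReal.Tendsto.const_mul (hfu.comp hns.tendsto_atTop)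
      (.inr (ENNReal.ofReal_ne_top (r := M)))
    rw [mul_zero] at hfuM
    refine tendsto_of_tendsto_of_tendsto_of_le_of_le tendsto_const_nhds hfuM
      (fun _ => zero_le) fun k => ?_
    exact eLpNorm_le_mul_eLpNorm_of_ae_le_mul
      (ae_of_all _ fun x => abs_primitive_sub_le hψ.continuous hM _ _) 2
  · simp_rw [pderiv_primitive_comp]
    refine tendsto_eLpNorm_smul_sub one_le_two ENNReal.ofNat_ne_top
      (fun k => (hψ.continuous.comp (hf (ns k)).cont).aestronglyMeasurable) (fun k x => hM _)
      (ae_restrict_of_ae ?_) (fun k => ((hf (ns k)).continuous_pderiv i).aestronglyMeasurable)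
      (H.memLp_grad i) ((hfh i).comp hns.tendsto_atTop)
    filter_upwards [hae] with x hx using (hψ.continuous.tendsto _).comp hx

lemma comp_primitive_of_tendsto (H : HasGradient s ϱ u h) {ψ : ℕ → ℝ → ℝ}
    (hψ : ∀ k, ContDiff ℝ 1 (ψ k)) (hM : ∀ k t, |ψ k t| ≤ M) {χ : ℝ → ℝ}
    (hχ : ∀ t, Tendsto (fun k => ψ k t) atTop (𝓝 (χ t))) :
    HasGradient s ϱ (fun x => primitive χ (u x)) fun i x => χ (u x) * h i x := by
  have hψu : ∀ k, AEStronglyMeasurable (fun x => ψ k (u x)) (refMeasure s ϱ) := fun k =>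
    (hψ k).continuous.comp_aestronglyMeasurable H.memLp.1
  have hχu : AEStronglyMeasurable (fun x => χ (u x)) (refMeasure s ϱ) :=
    aestronglyMeasurable_of_tendsto_ae atTop hψu (ae_of_all _ fun x => hχ (u x))
  have hχM : ∀ t, |χ t| ≤ M := fun t =>
    le_of_tendsto (hχ t).abs (Eventually.of_forall fun k => hM k t)
  have hlim := tendsto_primitive (fun k => (hψ k).continuous) hM hχ
  have hPψ : ∀ k, MemLp (fun x => primitive (ψ k) (u x)) 2 (refMeasure s ϱ) :=
    fun k => (H.comp_primitive (hψ k) (hM k)).memLp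
  have hPχ_le : ∀ t, |primitive χ t| ≤ M * |t| := fun t =>
    le_of_tendsto (hlim t).abs (Eventually.of_forall fun k =>
      abs_primitive_le (hψ k).continuous (hM k) t)
  have hPχ : MemLp (fun x => primitive χ (u x)) 2 (refMeasure s ϱ) :=
    H.memLp.of_le_mul (aestronglyMeasurable_of_tendsto_ae atTop (fun k => (hPψ k).1)
      (ae_of_all _ fun x => hlim (u x))) (ae_of_all _ fun x => hPχ_le _)
  refine of_tendsto (fun k => H.comp_primitive (hψ k) (hM k)) hPχ
    (fun i => (H.memLp_grad i).of_le_mul (c := M) (hχu.restrict.mul (H.memLp_grad i).1)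
      (ae_of_all _ fun x => ?_)) ?_ fun i => ?_
  · rw [norm_mul]
    exact mul_le_mul_of_nonneg_right (hχM _) (norm_nonneg _)
  · refine tendsto_eLpNorm_zero_of_dominated ENNReal.ofNat_ne_top
      (fun k => (hPψ k).1.sub hPχ.1) (H.memLp.norm.const_mul (2 * M))
      (fun k => ae_of_all _ fun x => ?_) (ae_of_all _ fun x => ?_)
    · refine (abs_sub _ _).trans (le_trans ?_ (le_abs_self _))
      rw [Real.norm_eq_abs]
      linarith [hPχ_le (u x), abs_primitive_le (hψ k).continuous (hM k) (u x)]
    · simpa using (hlim (u x)).sub_const (primitive χ (u x))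
  · exact tendsto_eLpNorm_smul_sub one_le_two ENNReal.ofNat_ne_top
      (fun k => (hψu k).restrict) (fun k x => hM _ _) (ae_of_all _ fun x => hχ (u x))
      (fun _ => (H.memLp_grad i).1) (H.memLp_grad i) (by simp)

lemma unitContraction (H : HasGradient s ϱ u h) :
    HasGradient s ϱ (fun x => min (max (u x) 0) 1)
      fun i x => (Set.Ioo 0 1).indicator 1 (u x) * h i x := by
  have hsm : ContDiff ℝ 1 Real.smoothTransition := Real.smoothTransition.contDiff
  have tendsto_indicator : ∀ t : ℝ, Tendsto (fun k : ℕ => Real.smoothTransition (k * t) *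
      Real.smoothTransition (k * (1 - t))) atTop (𝓝 ((Set.Ioo 0 1).indicator 1 t)) := fun t => by
    convert (tendsto_smoothTransition_nat_mul t).mul
      (tendsto_smoothTransition_nat_mul (1 - t)) using 2
    by_cases h0 : 0 < t <;> by_cases h1 : t < 1 <;> simp [Set.indicator, h0, h1]
  simpa only [primitive_indicator_Ioo] using H.comp_primitive_of_tendsto (M := 1)
    (fun _ => (hsm.comp (by fun_prop)).mul (hsm.comp (by fun_prop)))
    (fun _ _ => by
      rw [abs_mul]
      exact mul_le_one₀ (abs_smoothTransition_le_one _) (abs_nonneg _)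
        (abs_smoothTransition_le_one _))
    tendsto_indicator

-- The primitive of the indicator of `{c}` is `0`, so `1_{u = c} ∇ u` is a gradient of `0`.
lemma ae_eq_zero_of_eq (H : HasGradient s ϱ u h) (hcl : HasClosableGradient s ϱ) (c : ℝ)
    (i : Fin n) : ∀ᵐ x ∂tangentMeasure s ϱ i, u x = c → h i x = 0 := by
  have hsm : ContDiff ℝ 1 Real.smoothTransition := Real.smoothTransition.contDiff
  have tendsto_indicator : ∀ t : ℝ, Tendsto (fun k : ℕ =>
      1 - Real.smoothTransition (k * (t - c) ^ 2)) atTop (𝓝 (({c} : Set ℝ).indicator 1 t)) := by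
    intro t
    convert (tendsto_smoothTransition_nat_mul ((t - c) ^ 2)).const_sub 1 using 2
    rcases eq_or_ne t c with rfl | htc
    · simp
    · simp [htc, sq_pos_iff.2 (sub_ne_zero.2 htc)]
  have H' := H.comp_primitive_of_tendsto (M := 1)
    (fun k => contDiff_const.sub (hsm.comp (by fun_prop)))
    (fun _ _ => by
      rw [Function.comp_apply, abs_of_nonneg (sub_nonneg.2 (Real.smoothTransition.le_one _)),
        sub_le_self_iff]
      exact Real.smoothTransition.nonneg _)
    tendsto_indicator
  filter_upwards [hcl H' (ae_of_all _ fun x => primitive_indicator_singleton c (u x)) i]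
    with x hx hxc
  simpa [hxc] using hx

end HasGradient

lemma HamzaCondition.hasClosableGradient (hH : HamzaCondition s ϱ)
    (hϱ : AEMeasurable ϱ (baseMeasure n s)) (hpos : ∀ᵐ x ∂baseMeasure n s, 0 < ϱ x) :
    HasClosableGradient s ϱ := fun u h H hu i => by
  obtain ⟨f, hf, hfu, hfh⟩ := (H.congr hu fun i => EventuallyEq.rfl).exists_seq
  exact hH.ae_tangentMeasure_eq_zero hϱ hpos hf (H.memLp_grad i) (by simpa using hfu) (hfh i)

end Orthant

/-! ### The closed gradient and its Dirichlet form -/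

namespace Orthant

variable {n : ℕ} {s : ℝ} {ϱ : Orthant n → ℝ}

/-- The Hilbert space in which gradients take their values. -/
abbrev GradSpace (s : ℝ) (ϱ : Orthant n → ℝ) : Type :=
  PiLp 2 fun i : Fin n => Lp ℝ 2 (tangentMeasure s ϱ i)

/-- The set of the classes of `(f, ∇ f)` with `f ∈ C_c^2(E)`. -/
def gradGraph (s : ℝ) (ϱ : Orthant n → ℝ) :
    Submodule ℝ (Lp ℝ 2 (refMeasure s ϱ) × GradSpace s ϱ) where
  carrier := {p | ∃ f : Orthant n → ℝ, IsC2c f ∧ p.1 =ᵐ[refMeasure s ϱ] f ∧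
    ∀ i, p.2 i =ᵐ[tangentMeasure s ϱ i] pderiv i f}
  zero_mem' := by
    refine ⟨0, IsC2c.zero, Lp.coeFn_zero _ _ _, fun i => ?_⟩
    have hzero : pderiv i (0 : Orthant n → ℝ) = 0 := by
      simpa using pderiv_smul (IsC2c.zero (n := n)) 0 i
    rw [hzero]
    exact Lp.coeFn_zero _ _ _
  add_mem' := by
    rintro p q ⟨f, hf, hpf, hpf'⟩ ⟨g, hg, hqg, hqg'⟩
    refine ⟨f + g, hf.add hg, (Lp.coeFn_add _ _).trans (hpf.add hqg), fun i => ?_⟩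
    rw [pderiv_add hf hg]
    exact (Lp.coeFn_add _ _).trans ((hpf' i).add (hqg' i))
  smul_mem' := by
    rintro c p ⟨f, hf, hpf, hpf'⟩
    refine ⟨c • f, hf.smul c, (Lp.coeFn_smul _ _).trans (hpf.const_smul c), fun i => ?_⟩
    rw [pderiv_smul hf]
    exact (Lp.coeFn_smul _ _).trans ((hpf' i).const_smul c)

/-- The gradient on `C_c^2(E)`, as an unbounded operator. By the junk value of
`Submodule.toLinearPMap`, it is meaningful only if `gradGraph` is a graph. -/
def gradient (s : ℝ) (ϱ : Orthant n → ℝ) : Lp ℝ 2 (refMeasure s ϱ) →ₗ.[ℝ] GradSpace s ϱ :=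
  (gradGraph s ϱ).toLinearPMap

lemma IsC2c.mem_gradGraph [IsFiniteMeasure (refMeasure s ϱ)] {f : Orthant n → ℝ} (hf : IsC2c f)
    {u : Lp ℝ 2 (refMeasure s ϱ)} (hu : u =ᵐ[refMeasure s ϱ] f) :
    (u, WithLp.toLp 2 fun i => (hf.memLp_pderiv i _).toLp) ∈ gradGraph s ϱ :=
  ⟨f, hf, hu, fun i => (hf.memLp_pderiv i _).coeFn_toLp⟩

lemma mem_domain_gradient [IsFiniteMeasure (refMeasure s ϱ)] {u : Lp ℝ 2 (refMeasure s ϱ)} :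
    u ∈ (gradient s ϱ).domain ↔ ∃ f : Orthant n → ℝ, IsC2c f ∧ u =ᵐ[refMeasure s ϱ] f := by
  constructor
  · rintro ⟨p, ⟨f, hf, hpf, -⟩, rfl⟩
    exact ⟨f, hf, hpf⟩
  · rintro ⟨f, hf, hu⟩
    exact ⟨_, hf.mem_gradGraph hu, rfl⟩

lemma hasGradient_of_mem_closure_gradGraph {p : Lp ℝ 2 (refMeasure s ϱ) × GradSpace s ϱ}
    (hp : p ∈ (gradGraph s ϱ).topologicalClosure) : HasGradient s ϱ p.1 fun i => p.2 i where
  memLp := Lp.memLp _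
  memLp_grad _ := Lp.memLp _
  approx ε hε := by
    obtain ⟨q, ⟨f, hf, hqf, hqf'⟩, hpq⟩ := EMetric.mem_closure_iff.1 hp ε hε
    rw [Prod.edist_eq, max_lt_iff] at hpq
    refine ⟨f, hf, ?_, fun i => ?_⟩
    · rw [← eLpNorm_congr_ae (hqf.sub EventuallyEq.rfl), ← Lp.edist_def, edist_comm]
      exact hpq.1
    · rw [← eLpNorm_congr_ae ((hqf' i).sub EventuallyEq.rfl), ← Lp.edist_def, edist_comm]
      exact (PiLp.edist_apply_le p.2 q.2 i).trans_lt hpq.2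

lemma HasGradient.mem_closure_gradGraph [IsFiniteMeasure (refMeasure s ϱ)] {u : Orthant n → ℝ}
    {h : Fin n → Orthant n → ℝ} (H : HasGradient s ϱ u h) :
    (H.memLp.toLp, WithLp.toLp 2 fun i => (H.memLp_grad i).toLp) ∈
      (gradGraph s ϱ).topologicalClosure := by
  obtain ⟨f, hf, hfu, hfh⟩ := H.exists_seq
  refine mem_closure_of_tendsto (Tendsto.prodMk_nhds
    ((Lp.tendsto_Lp_iff_tendsto_eLpNorm'' f (fun k => (hf k).memLp _) u H.memLp).2 hfu)
    (((PiLp.continuous_toLp 2 _).tendsto _).comp (tendsto_pi_nhds.2 fun i =>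
      (Lp.tendsto_Lp_iff_tendsto_eLpNorm'' _ (fun k => (hf k).memLp_pderiv i _) (h i)
        (H.memLp_grad i)).2 (hfh i)))) (.of_forall fun k => ?_)
  exact (hf k).mem_gradGraph ((hf k).memLp _).coeFn_toLp

lemma HasClosableGradient.eq_zero_of_mem_closure_gradGraph (hcl : HasClosableGradient s ϱ)
    {p : Lp ℝ 2 (refMeasure s ϱ) × GradSpace s ϱ} (hp : p ∈ (gradGraph s ϱ).topologicalClosure)
    (hp0 : p.1 = 0) : p.2 = 0 := by
  ext1 i
  exact Lp.eq_zero_iff_ae_eq_zero.2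
    (hcl (hasGradient_of_mem_closure_gradGraph hp) (hp0 ▸ Lp.coeFn_zero _ _ _) i)

section Closable

variable (hcl : HasClosableGradient s ϱ)
include hcl

lemma graph_gradient : (gradient s ϱ).graph = gradGraph s ϱ :=
  Submodule.toLinearPMap_graph_eq _ fun _ hp =>
    hcl.eq_zero_of_mem_closure_gradGraph (Submodule.le_topologicalClosure _ hp)

lemma isClosable_gradient : (gradient s ϱ).IsClosable :=
  ⟨(gradGraph s ϱ).topologicalClosure.toLinearPMap, by
    rw [graph_gradient hcl, Submodule.toLinearPMap_graph_eq _ fun _ =>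
      hcl.eq_zero_of_mem_closure_gradGraph]⟩

lemma graph_closure_gradient :
    (gradient s ϱ).closure.graph = (gradGraph s ϱ).topologicalClosure := by
  rw [← (isClosable_gradient hcl).graph_closure_eq_closure_graph, graph_gradient hcl]

lemma gradient_ae_eq [IsFiniteMeasure (refMeasure s ϱ)] {u : (gradient s ϱ).domain}
    {f : Orthant n → ℝ} (hf : IsC2c f) (hu : u.1 =ᵐ[refMeasure s ϱ] f) (i : Fin n) :
    gradient s ϱ u i =ᵐ[tangentMeasure s ϱ i] pderiv i f := by
  have hmem := hf.mem_gradGraph hu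
  rw [← graph_gradient hcl, ← LinearPMap.image_iff u.2] at hmem
  rw [← hmem]
  exact (hf.memLp_pderiv i _).coeFn_toLp

lemma hasGradient_closure_gradient (u : (gradient s ϱ).closure.domain) :
    HasGradient s ϱ u.1 fun i => (gradient s ϱ).closure u i :=
  hasGradient_of_mem_closure_gradGraph
    (graph_closure_gradient hcl ▸ (gradient s ϱ).closure.mem_graph u)

lemma HasGradient.exists_closure_gradient_ae_eq [IsFiniteMeasure (refMeasure s ϱ)]
    {u : Orthant n → ℝ} {h : Fin n → Orthant n → ℝ} (H : HasGradient s ϱ u h) :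
    ∃ w : (gradient s ϱ).closure.domain, w.1 =ᵐ[refMeasure s ϱ] u ∧
      ∀ i, (gradient s ϱ).closure w i =ᵐ[tangentMeasure s ϱ i] h i := by
  have hmem := H.mem_closure_gradGraph
  rw [← graph_closure_gradient hcl, LinearPMap.mem_graph_iff] at hmem
  obtain ⟨w, hwu, hwh⟩ := hmem
  refine ⟨w, hwu ▸ H.memLp.coeFn_toLp, fun i => hwh ▸ (H.memLp_grad i).coeFn_toLp⟩

end Closable

lemma inner_gradSpace (h k : GradSpace s ϱ) :
    inner ℝ h k = ∑ i, ∫ x, h i x * k i x ∂tangentMeasure s ϱ i := by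
  simp only [PiLp.inner_apply, L2.inner_def, RCLike.inner_apply, conj_trivial, mul_comm]

lemma isEnergyForm_gradient [IsFiniteMeasure (refMeasure s ϱ)] (hcl : HasClosableGradient s ϱ) :
    IsEnergyForm s ϱ (PartialForm.ofLinearPMap (gradient s ϱ)) where
  memLp _ hf := hf.memLp _
  mem_dom_iff _ := mem_domain_gradient
  integrable f g hf hg B i _ := by
    rw [IntegrableOn, ← refMeasure_restrict_face]
    exact hf.integrable_pderiv_mul hg i _
  form_eq u v f g hf hg hu hv := by
    rw [PartialForm.ofLinearPMap_form_apply, inner_gradSpace, energy_eq hf hg]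
    exact Finset.sum_congr rfl fun i _ =>
      integral_congr_ae ((gradient_ae_eq hcl hf hu i).mul (gradient_ae_eq hcl hg hv i))

lemma dense_domain_gradient [IsFiniteMeasure (refMeasure s ϱ)] :
    Dense ((gradient s ϱ).domain : Set (Lp ℝ 2 (refMeasure s ϱ))) := by
  intro u
  refine EMetric.mem_closure_iff.2 fun ε hε => ?_
  have hmap : MemLp ((u : Orthant n → ℝ) ∘ proj) 2 ((refMeasure s ϱ).map Subtype.val) := by
    simpa [measurableEmbedding_val.memLp_map_measure_iff, Function.comp_def] using Lp.memLp u
  obtain ⟨δ, hδ0, hδε⟩ := ENNReal.lt_iff_exists_nnreal_btwn.1 hε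
  obtain ⟨g, hgs, hgc, hg⟩ := hmap.exist_eLpNorm_sub_le ENNReal.ofNat_ne_top one_le_two
    (ε := δ) (NNReal.coe_pos.2 (ENNReal.coe_pos.1 hδ0))
  have hgC : IsC2c fun x : Orthant n => g x.1 := isC2c_restrict (contDiff_infty.1 hgc 2) hgs
  have hgL := (hgC.memLp (refMeasure s ϱ)).coeFn_toLp
  refine ⟨_, mem_domain_gradient.2 ⟨_, hgC, hgL⟩, ?_⟩
  rw [measurableEmbedding_val.eLpNorm_map_measure, ENNReal.ofReal_coe_nnreal] at hg
  rw [Lp.edist_def, eLpNorm_congr_ae (EventuallyEq.rfl.sub hgL)]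
  exact (le_of_eq (by simp [Function.comp_def, Pi.sub_def])).trans_lt (hg.trans_lt hδε)

-- `x ↦ |x|` is a proper retraction of `ℝⁿ` onto `E`, so it pulls `C_c(E)` back to `C_c(ℝⁿ)`.
lemma exists_isC2c_abs_sub_lt {f : Orthant n → ℝ} (hf : Continuous f) (hs : HasCompactSupport f)
    {ε : ℝ} (hε : 0 < ε) : ∃ g : Orthant n → ℝ, IsC2c g ∧ ∀ x, |f x - g x| < ε := by
  let a : (Fin n → ℝ) → Orthant n := fun x => ⟨fun i => |x i|, fun i => abs_nonneg _⟩
  have ha : Continuous a := by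
    unfold a
    fun_prop
  have ha_coe : ∀ x : Orthant n, a x.1 = x := fun x =>
    Subtype.ext (funext fun i => abs_of_nonneg (x.2 i))
  have hfa : HasCompactSupport (f ∘ a) := by
    obtain ⟨R, hR⟩ := (hs.isCompact.image continuous_subtype_val).isBounded.subset_closedBall 0
    refine HasCompactSupport.intro (isCompact_closedBall (0 : Fin n → ℝ) R) fun x hx => ?_
    refine image_eq_zero_of_notMem_tsupport (f := f) (x := a x) fun hm => hx ?_
    have hnorm : ‖(a x).1‖ = ‖x‖ := by simp [a, Pi.norm_def]
    simpa [hnorm] using hR (Set.mem_image_of_mem _ hm)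
  obtain ⟨g, hgc, hg, hgs⟩ := (hf.comp ha).exists_contDiff_approx ⊤ (ε := fun _ => ε)
    continuous_const fun _ => hε
  refine ⟨fun x => g x.1, isC2c_restrict (contDiff_infty.1 hgc 2) (hfa.mono hgs), fun x => ?_⟩
  simpa [ha_coe, Real.dist_eq, abs_sub_comm] using hg x.1

section Dilation

variable {G : (Fin n → ℝ) → ℝ}

lemma isC2c_restrict_comp_smul (hG : ContDiff ℝ 2 G) (hs : HasCompactSupport G) {c : ℝ}
    (hc : c ≠ 0) : IsC2c fun x : Orthant n => G (c • x.1) :=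
  isC2c_restrict (hG.comp (contDiff_const_smul c)) (hs.comp_smul hc)

lemma pderiv_restrict_comp_smul (hG : ContDiff ℝ 1 G) (c : ℝ) (i : Fin n) :
    pderiv i (fun x : Orthant n => G (c • x.1)) =
      fun x => c * fderiv ℝ G (c • x.1) (Pi.single i 1) := by
  rw [pderiv_restrict (G := fun y => G (c • y)) (hG.comp (contDiff_const_smul c))]
  ext x
  simp only [fderiv_comp_smul, smul_apply, smul_eq_mul]

lemma hasGradient_const_of_hasCompactSupport [IsFiniteMeasure (refMeasure s ϱ)]
    (hG : ContDiff ℝ 2 G) (hs : HasCompactSupport G) :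
    HasGradient s ϱ (fun _ => G 0) fun _ _ => 0 := by
  let c : ℕ → ℝ := fun k => 1 / ((k : ℝ) + 1)
  have hc0 : ∀ k, 0 < c k := fun k => Nat.one_div_pos_of_nat
  have hc1 : ∀ k, c k ≤ 1 := fun k => div_le_one_of_le₀ (by simp) (by positivity)
  have hc : Tendsto c atTop (𝓝 0) := tendsto_one_div_add_atTop_nhds_zero_nat
  have hsmul : ∀ x : Fin n → ℝ, Tendsto (fun k => c k • x) atTop (𝓝 0) := fun x => by
    simpa using hc.smul_const x
  have hf : ∀ k, IsC2c fun x : Orthant n => G (c k • x.1) := fun k =>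
    isC2c_restrict_comp_smul hG hs (hc0 k).ne'
  obtain ⟨C, hC⟩ := hs.exists_bound_of_continuous hG.continuous
  refine HasGradient.of_tendsto (fun k => (hf k).hasGradient) (memLp_const _)
    (fun i => memLp_const 0) ?_ fun i => ?_
  · refine tendsto_eLpNorm_zero_of_dominated ENNReal.ofNat_ne_top (G := fun _ => C + C)
      (fun k => ((hf k).cont.sub continuous_const).aestronglyMeasurable) (memLp_const _)
      (fun k => ae_of_all _ fun x => ?_) (ae_of_all _ fun x => ?_)
    · exact (norm_sub_le _ _).trans ((add_le_add (hC _) (hC 0)).trans (le_abs_self _))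
    · simpa using ((hG.continuous.tendsto 0).comp (hsmul x.1)).sub_const (G 0)
  · have hD : Continuous fun x => fderiv ℝ G x (Pi.single i 1) :=
      (hG.continuous_fderiv two_ne_zero).clm_apply continuous_const
    obtain ⟨D, hD'⟩ := (hs.fderiv_apply ℝ (Pi.single i 1)).exists_bound_of_continuous hD
    simp_rw [pderiv_restrict_comp_smul (hG.of_le one_le_two)]
    refine tendsto_eLpNorm_zero_of_dominated ENNReal.ofNat_ne_top (G := fun _ => D) (fun k => ?_)
      (memLp_const D) (fun k => ae_of_all _ fun x => ?_) (ae_of_all _ fun x => ?_)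
    · exact ((continuous_const.mul (hD.comp (by fun_prop))).sub
        continuous_const).aestronglyMeasurable
    · rw [Pi.sub_apply, sub_zero, norm_mul, Real.norm_of_nonneg (hc0 k).le]
      exact (mul_le_of_le_one_left (norm_nonneg _) (hc1 k)).trans
        ((hD' _).trans (le_abs_self D))
    · simpa using hc.mul ((hD.tendsto 0).comp (hsmul x.1))

end Dilation

lemma hasGradient_one [IsFiniteMeasure (refMeasure s ϱ)] :
    HasGradient s ϱ (fun _ => 1) fun _ _ => 0 := by
  let β : ContDiffBump (0 : Fin n → ℝ) := ⟨1, 2, one_pos, one_lt_two⟩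
  have hβ : β 0 = 1 := β.one_of_mem_closedBall (Metric.mem_closedBall_self β.rIn_pos.le)
  exact hβ ▸ hasGradient_const_of_hasCompactSupport β.contDiff β.hasCompactSupport

section Closure

variable [IsFiniteMeasure (refMeasure s ϱ)] (hcl : HasClosableGradient s ϱ)
include hcl

lemma isMarkovian_closure_gradient :
    (PartialForm.ofLinearPMap (gradient s ϱ).closure).IsMarkovian := by
  intro u v hv
  obtain ⟨w, hw, hwh⟩ :=
    (hasGradient_closure_gradient hcl u).unitContraction.exists_closure_gradient_ae_eq hcl
  obtain rfl : w.1 = v := Lp.ext (hw.trans hv.symm)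
  refine ⟨w.2, ?_⟩
  rw [PartialForm.ofLinearPMap_form_apply, PartialForm.ofLinearPMap_form_apply,
    real_inner_self_eq_norm_sq, real_inner_self_eq_norm_sq, PiLp.norm_sq_eq_of_L2,
    PiLp.norm_sq_eq_of_L2]
  gcongr with i
  refine Lp.norm_le_norm_of_ae_le ?_
  filter_upwards [hwh i] with x hx
  rw [hx, norm_mul]
  refine mul_le_of_le_one_left (norm_nonneg _) ?_
  exact (norm_indicator_le_norm_self _ _).trans norm_one.le

lemma isStronglyLocal_closure_gradient :
    (PartialForm.ofLinearPMap (gradient s ϱ).closure).IsStronglyLocal := by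
  rintro u v - - ⟨U, hU, hsub, c, hc⟩
  rw [PartialForm.ofLinearPMap_form_apply, inner_gradSpace]
  refine Finset.sum_eq_zero fun i _ => integral_eq_zero_of_ae ?_
  filter_upwards [(hasGradient_closure_gradient hcl u).ae_eq_zero_of_eq hcl 0 i,
    (hasGradient_closure_gradient hcl v).ae_eq_zero_of_eq hcl c i,
    ae_restrict_of_ae (PartialForm.ae_eq_zero_of_notMem_lpSupport u.1),
    ae_restrict_of_ae ((ae_restrict_iff' hU.measurableSet).1 hc)] with x hgu hgv hux hvx
  by_cases hx : x ∈ U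
  · simp [hgv (hvx hx)]
  · simp [hgu (hux fun hm => hx (hsub hm))]

lemma isRegular_closure_gradient :
    (PartialForm.ofLinearPMap (gradient s ϱ).closure).IsRegular := by
  obtain ⟨-, hle, -, happrox⟩ := PartialForm.isClosureOf_ofLinearPMap (isClosable_gradient hcl)
  refine ⟨fun u ε hε => ?_, fun f hf hfs ε hε => ?_⟩
  · obtain ⟨v, hv⟩ := happrox u ε hε
    obtain ⟨f, hf, hvf⟩ := mem_domain_gradient.1 v.2
    exact ⟨Submodule.inclusion hle v, ⟨f, hf.cont, hf.supp, hvf⟩, hv⟩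
  · obtain ⟨g, hg, hfg⟩ := exists_isC2c_abs_sub_lt hf hfs hε
    have hgL := (hg.memLp (refMeasure s ϱ)).coeFn_toLp
    exact ⟨g, hg.cont, hg.supp, ⟨⟨_, hle (mem_domain_gradient.2 ⟨g, hg, hgL⟩)⟩, hgL⟩, hfg⟩

lemma isConservative_closure_gradient :
    (PartialForm.ofLinearPMap (gradient s ϱ).closure).IsConservative := by
  obtain ⟨e, he, hgrad⟩ := hasGradient_one.exists_closure_gradient_ae_eq hcl
  have hzero : (gradient s ϱ).closure e = 0 := by
    ext1 i
    exact Lp.eq_zero_iff_ae_eq_zero.2 (hgrad i)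
  refine ⟨e, he, fun t _ => (PartialForm.isPositive_ofLinearPMap _).isSemigroupValue_self
    (fun v => ?_) t⟩
  rw [PartialForm.ofLinearPMap_form_apply, hzero, inner_zero_left]

lemma isSymmetricDirichletForm_closure_gradient :
    (PartialForm.ofLinearPMap (gradient s ϱ).closure).IsSymmetricDirichletForm where
  dense := dense_domain_gradient.mono (gradient s ϱ).le_closure.1
  symm := PartialForm.isSymmetric_ofLinearPMap _
  pos := PartialForm.isPositive_ofLinearPMap _
  closed := PartialForm.isClosed_ofLinearPMap (isClosable_gradient hcl).closure_isClosed
  markov := isMarkovian_closure_gradient hcl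

end Closure

end Orthant

end

theorem mainTheorem4 (n : ℕ) (hn : 1 ≤ n) (s : ℝ) (hs : 0 < s) (ϱ : Orthant n → ℝ)
    (hpos : ∀ᵐ x ∂(Orthant.baseMeasure n s), 0 < ϱ x)
    (hint : MeasureTheory.Integrable ϱ (Orthant.baseMeasure n s))
    (hHamza : Orthant.HamzaCondition s ϱ) :
    ∃ F : PartialForm (MeasureTheory.Lp ℝ 2 (Orthant.refMeasure s ϱ)),
      Orthant.IsEnergyForm s ϱ F ∧
      F.IsDenselyDefined ∧ F.IsSymmetric ∧ F.IsPositive ∧ F.IsClosable ∧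
      ∃ G : PartialForm (MeasureTheory.Lp ℝ 2 (Orthant.refMeasure s ϱ)),
        G.IsClosureOf F ∧
        G.IsSymmetricDirichletForm ∧ G.IsRegular ∧ G.IsStronglyLocal ∧ G.IsConservative := by
  have := Orthant.isFiniteMeasure_refMeasure hint
  have hcl := hHamza.hasClosableGradient hint.1.aemeasurable hpos
  have hT := Orthant.isClosable_gradient hcl
  exact ⟨.ofLinearPMap (Orthant.gradient s ϱ), Orthant.isEnergyForm_gradient hcl,
    Orthant.dense_domain_gradient, PartialForm.isSymmetric_ofLinearPMap _,
    PartialForm.isPositive_ofLinearPMap _, PartialForm.isClosable_ofLinearPMap hT,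
    .ofLinearPMap (Orthant.gradient s ϱ).closure, PartialForm.isClosureOf_ofLinearPMap hT,
    Orthant.isSymmetricDirichletForm_closure_gradient hcl,
    Orthant.isRegular_closure_gradient hcl,
    Orthant.isStronglyLocal_closure_gradient hcl,
    Orthant.isConservative_closure_gradient hcl⟩
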